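/- Fix a prime $p$. A fusion system on a finite $p$-group $S$ is a category $\mathcal F$ whose objects are the subgroups of $S$, whose morphism sets $\mathrm{Hom}_{\mathcal F}(P,Q)$ consist of injective homomorphisms and contain all those induced by conjugation in $S$, and in which each morphism is an $\mathcal F$-isomorphism onto its image followed by an inclusion. A morphism from $\mathcal F$ (on $S$) to $\mathcal E$ (on $R$) is a homomorphism $\varphi:S\to R$ such that for all $P,Q\le S$ and $\alpha\in\mathrm{Hom}_{\mathcal F}(P,Q)$ there is $\beta\in\mathrm{Hom}_{\mathcal E}(\varphi(P),\varphi(Q))$ with $\varphi|_Q\circ\alpha=\beta\circ\varphi|_P$. For a finite $p$-subgroup $S$ of a (possibly infinite) group $G$, $\mathcal F_S(G)$ is the fusion system on $S$ whose morphisms are the homomorphisms between subgroups of $S$ induced by conjugation by elements of $G$; $S$ is called a Sylow $p$-subgroup of $G$ if every finite $p$-subgroup of $G$ is $G$-conjugate to a subgroup of $S$. Let $(\mathcal T,\mathcal G)$ be a tree of finite groups: $\mathcal T$ is a tree, each vertex $v$ and edge $e$ carries a finite group $\mathcal G(v)$, $\mathcal G(e)$, and there is a monomorphism $\mathcal G(f_{ev}):\mathcal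 G(e)\to\mathcal G(v)$ whenever $v$ is an end of $e$. Let $\mathcal G_{\mathcal T}$ be its completion, i.e. the colimit of these groups. Choose Sylow $p$-subgroups $\mathcal S(v)$ of $\mathcal G(v)$ and $\mathcal S(e)$ of $\mathcal G(e)$, and elements $g_{ev}\in\mathcal G(v)$ such that $g_{ev}^{-1}\,\mathcal G(f_{ev})(\mathcal S(e))\,g_{ev}\le\mathcal S(v)$. The induced tree of fusion systems $(\mathcal T,\mathcal F,\mathcal S)$ consists of the fusion systems $\mathcal F(v)=\mathcal F_{\mathcal S(v)}(\mathcal G(v))$ and $\mathcal F(e)=\mathcal F_{\mathcal S(e)}(\mathcal G(e))$ together with the injective morphisms $\mathcal S(e)\to\mathcal S(v)$, $x\mapsto g_{ev}^{-1}\,\mathcal G(f_{ev})(x)\,g_{ev}$. A completion $\mathcal F_{\mathcal T}$ of $(\mathcal T,\mathcal F,\mathcal S)$ is a colimit of this diagram in the category of fusion systems on finite $p$-groups. Suppose that $(\mathcal T,\mathcal F,\mathcal S)$ satisfies the following condition for a vertex $v_*$: $(H)$: for each vertex $v\ne v_*$, $\mathcal S(e)\cong\mathcal S(v)$, where $e$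 is the edge incident to $v$ in the unique path of $\mathcal T$ from $v$ to $v_*$. Then a completion $\mathcal F_{\mathcal T}$ exists, and the following hold. (a) The map $\mathcal S(v_*)\to\mathcal G_{\mathcal T}$ is injective, and (its image) $\mathcal S(v_*)$ is a Sylow $p$-subgroup of $\mathcal G_{\mathcal T}$. (b) $\mathcal F_{\mathcal S(v_*)}(\mathcal G_{\mathcal T})=\mathcal F_{\mathcal T}$, where $\mathcal S(v_*)$ is identified with the group underlying $\mathcal F_{\mathcal T}$ by means of the canonical map, which is an isomorphism. In particular, $\mathcal F_{\mathcal T}$ is, up to isomorphism of fusion systems, independent of the choices: if another choice of $\mathcal S(v)$, $\mathcal S(e)$, $g_{ev}$ gives an induced tree of fusion systems which satisfies $(H)$ for some vertex, then its completion is isomorphic to $\mathcal F_{\mathcal T}$. -/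

import Mathlib

universe w u u₁ u₂ u₃

/-! ## Fusion systems -/

/-- A fusion system (at `p`) on a finite `p`-group `S`: a category whose objects are the subgroups
of `S`, whose morphisms are injective homomorphisms and include all those induced by conjugation
in `S`, and in which each morphism is an isomorphism onto its image followed by an inclusion.
(Identities and inclusions are conjugations by `1`.) -/
@[ext]
structure FusionSystem (p : ℕ) (S : Type u) [Group S] where
  Hom : (P Q : Subgroup S) → Set (P →* Q)
  finite : Finite S
  isPGroup : IsPGroup p S
  conj_mem : ∀ (P Q : Subgroup S) (φ : P →* Q),
    (∃ s : S, ∀ x : P, (φ x : S) = s⁻¹ * (x : S) * s) → φ ∈ Hom P Q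
  injective : ∀ (P Q : Subgroup S) (φ : P →* Q), φ ∈ Hom P Q → Function.Injective φ
  comp_mem : ∀ (P Q R : Subgroup S) (φ : P →* Q) (ψ : Q →* R),
    φ ∈ Hom P Q → ψ ∈ Hom Q R → ψ.comp φ ∈ Hom P R
  factor : ∀ (P Q : Subgroup S) (φ : P →* Q), φ ∈ Hom P Q →
    (Q.subtype.comp φ).rangeRestrict ∈ Hom P (Q.subtype.comp φ).range ∧
    ∃ ψ ∈ Hom (Q.subtype.comp φ).range P,
      ψ.comp (Q.subtype.comp φ).rangeRestrict = MonoidHom.id P ∧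
      (Q.subtype.comp φ).rangeRestrict.comp ψ = MonoidHom.id (Q.subtype.comp φ).range

namespace FusionSystem

/-- `φ : S → R` is a morphism of fusion systems `F → E`: each `α ∈ Hom_F(P,Q)` has a
`β ∈ Hom_E(φ(P),φ(Q))` with `φ|_Q ∘ α = β ∘ φ|_P`. -/
def IsMorphism {p : ℕ} {S : Type u₁} [Group S] {R : Type u₂} [Group R]
    (F : FusionSystem p S) (E : FusionSystem p R) (φ : S →* R) : Prop :=
  ∀ (P Q : Subgroup S), ∀ α ∈ F.Hom P Q,
    ∃ β ∈ E.Hom (P.map φ) (Q.map φ), (φ.subgroupMap Q).comp α = β.comp (φ.subgroupMap P)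

/-- A morphism `φ` is injective if the maps `Hom_F(P,S) → Hom_E(φ(P),R)` which it induces are
injective. (The image of `α` is determined by the map `φ ∘ α`.) -/
def IsInjectiveMorphism {p : ℕ} {S : Type u₁} [Group S] {R : Type u₂} [Group R]
    (F : FusionSystem p S) (E : FusionSystem p R) (φ : S →* R) : Prop :=
  F.IsMorphism E φ ∧
    ∀ (P : Subgroup S), ∀ α ∈ F.Hom P ⊤, ∀ α' ∈ F.Hom P ⊤,
      (φ.subgroupMap ⊤).comp α = (φ.subgroupMap ⊤).comp α' → α = α'

/-- `θ` is an isomorphism in the category of fusion systems. -/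
def IsIso {p : ℕ} {S : Type u₁} [Group S] {R : Type u₂} [Group R]
    (F : FusionSystem p S) (E : FusionSystem p R) (θ : S ≃* R) : Prop :=
  F.IsMorphism E θ.toMonoidHom ∧ E.IsMorphism F θ.symm.toMonoidHom

/-- Conjugation `x ↦ g⁻¹ x g` by an element `g` of `G`, as a homomorphism `P → Q`
between subgroups of a subgroup `S` of `G`. -/
def conjHom {G : Type u} [Group G] {S : Subgroup G} {P Q : Subgroup S} (g : G)
    (h : ∀ x ∈ P, ∃ y ∈ Q, (y : G) = g⁻¹ * (x : G) * g) : P →* Q where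
  toFun x := ⟨⟨g⁻¹ * ((x : S) : G) * g, by
      obtain ⟨y, _, e⟩ := h x x.2; rw [← e]; exact y.2⟩, by
      obtain ⟨y, hy, e⟩ := h x x.2
      have : (⟨g⁻¹ * ((x : S) : G) * g, by rw [← e]; exact y.2⟩ : S) = y := Subtype.ext e.symm
      rw [this]; exact hy⟩
  map_one' := by ext; simp
  map_mul' a b := by ext; simp [mul_assoc]

/-- The fusion system `F_S(G)` of a (possibly infinite) group `G` on a finite `p`-subgroup `S`:
its morphisms are all homomorphisms between subgroups of `S` induced by conjugation in `G`. -/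
def ofGroup {p : ℕ} {G : Type u} [Group G] (S : Subgroup G) (hfin : Finite S)
    (hp : IsPGroup p S) : FusionSystem p S where
  Hom P Q := {φ | ∃ g : G, ∀ x : P, ((φ x : S) : G) = g⁻¹ * ((x : S) : G) * g}
  finite := hfin
  isPGroup := hp
  conj_mem := by
    rintro P Q φ ⟨s, hs⟩
    exact ⟨s, fun x => by rw [hs x]; simp⟩
  injective := by
    rintro P Q φ ⟨g, hg⟩ x y hxy
    have h := hg x
    rw [hxy, hg y] at h
    exact (Subtype.ext (Subtype.ext (mul_left_cancel (mul_right_cancel h)))).symm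
  comp_mem := by
    rintro P Q R φ ψ ⟨g, hg⟩ ⟨h, hh⟩
    exact ⟨g * h, fun x => by simp [hh, hg, mul_assoc]⟩
  factor := by
    rintro P Q φ ⟨g, hg⟩
    refine ⟨⟨g, fun x => by simp [hg]⟩, conjHom g⁻¹ ?_, ⟨g⁻¹, fun x => rfl⟩, ?_, ?_⟩
    · rintro _ ⟨x, rfl⟩
      exact ⟨x, x.2, by simp [hg, mul_assoc]⟩
    · ext x
      simp [conjHom, hg, mul_assoc]
    · ext ⟨_, x, rfl⟩
      simp [conjHom, hg, mul_assoc]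

end FusionSystem

/-- A Sylow `p`-subgroup of a possibly infinite group `G`: a finite `p`-subgroup `S` such that
every finite `p`-subgroup of `G` is `G`-conjugate to a subgroup of `S`. -/
def IsSylowSubgroup (p : ℕ) {G : Type u} [Group G] (S : Subgroup G) : Prop :=
  Finite S ∧ IsPGroup p S ∧
    ∀ P : Subgroup G, Finite P → IsPGroup p P → ∃ g : G, ∀ x ∈ P, g⁻¹ * x * g ∈ S

/-! ## Trees of groups -/

/-- A tree of groups `(T, G)`: a tree `T`, a group for each vertex and each edge, and a
monomorphism `G(e) → G(v)` whenever the vertex `v` lies on the edge `e`. -/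
structure TreeOfGroups {V : Type w} (T : SimpleGraph V) where
  isTree : T.IsTree
  vert : V → Type u
  edge : T.edgeSet → Type u
  [vertGroup : ∀ v, Group (vert v)]
  [edgeGroup : ∀ e, Group (edge e)]
  map : ∀ (e : T.edgeSet) (v : V), v ∈ (e : Sym2 V) → edge e →* vert v
  map_injective : ∀ e v hv, Function.Injective (map e v hv)

attribute [instance] TreeOfGroups.vertGroup TreeOfGroups.edgeGroup

namespace TreeOfGroups

/-- A tree of finite groups. -/
class IsFinite {V : Type w} {T : SimpleGraph V} (𝒢 : TreeOfGroups.{w, u} T) : Prop where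
  vert : ∀ v, Finite (𝒢.vert v)
  edge : ∀ e, Finite (𝒢.edge e)

/-- The relators which identify, for each edge `e` with ends `v` and `w`, the images of `G(e)` in
`G(v)` and `G(w)`. -/
def relators {V : Type w} {T : SimpleGraph V} (𝒢 : TreeOfGroups.{w, u} T) :
    Set (Monoid.CoprodI 𝒢.vert) :=
  {r | ∃ (e : T.edgeSet) (v v' : V) (hv : v ∈ (e : Sym2 V)) (hv' : v' ∈ (e : Sym2 V))
    (x : 𝒢.edge e), r = Monoid.CoprodI.of (𝒢.map e v hv x) *
      (Monoid.CoprodI.of (𝒢.map e v' hv' x))⁻¹}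

/-- The completion `G_T` of a tree of groups: the colimit of the groups, i.e. the free product of
the vertex groups modulo the identifications along the edges. -/
abbrev completion {V : Type w} {T : SimpleGraph V} (𝒢 : TreeOfGroups.{w, u} T) : Type (max w u) :=
  Monoid.CoprodI 𝒢.vert ⧸ Subgroup.normalClosure 𝒢.relators

/-- The canonical map `G(v) → G_T`. -/
def toCompletion {V : Type w} {T : SimpleGraph V} (𝒢 : TreeOfGroups.{w, u} T) (v : V) :
    𝒢.vert v →* 𝒢.completion :=
  (QuotientGroup.mk' (Subgroup.normalClosure 𝒢.relators)).comp Monoid.CoprodI.of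

/-- The canonical maps agree on the edge groups. -/
theorem toCompletion_map {V : Type w} {T : SimpleGraph V} (𝒢 : TreeOfGroups.{w, u} T)
    (e : T.edgeSet) (v v' : V) (hv : v ∈ (e : Sym2 V)) (hv' : v' ∈ (e : Sym2 V))
    (x : 𝒢.edge e) :
    𝒢.toCompletion v (𝒢.map e v hv x) = 𝒢.toCompletion v' (𝒢.map e v' hv' x) := by
  rw [← mul_inv_eq_one, ← map_inv]
  simp only [toCompletion, MonoidHom.comp_apply, ← map_mul]
  refine (QuotientGroup.eq_one_iff _).2 (Subgroup.subset_normalClosure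
    ⟨e, v, v', hv, hv', x, by simp⟩)

/-- The universal property of the completion. -/
theorem existsUnique_lift {V : Type w} {T : SimpleGraph V} (𝒢 : TreeOfGroups.{w, u} T)
    {K : Type u₃} [Group K] (f : ∀ v, 𝒢.vert v →* K)
    (hf : ∀ (e : T.edgeSet) (v v' : V) (hv : v ∈ (e : Sym2 V)) (hv' : v' ∈ (e : Sym2 V)),
      (f v).comp (𝒢.map e v hv) = (f v').comp (𝒢.map e v' hv')) :
    ∃! F : 𝒢.completion →* K, ∀ v, F.comp (𝒢.toCompletion v) = f v := by
  refine ⟨QuotientGroup.lift _ (Monoid.CoprodI.lift f) ?_, ?_, ?_⟩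
  · intro r hr
    have : Subgroup.normalClosure 𝒢.relators ≤ (Monoid.CoprodI.lift f).ker := by
      refine Subgroup.normalClosure_le_normal ?_
      rintro _ ⟨e, v, v', hv, hv', x, rfl⟩
      have := DFunLike.congr_fun (hf e v v' hv hv') x
      simp only [MonoidHom.comp_apply] at this
      simp [MonoidHom.mem_ker, this]
    exact this hr
  · intro v
    ext x
    simp [toCompletion]
  · intro F hF
    ext v x
    simpa [toCompletion] using DFunLike.congr_fun (hF v) x

end TreeOfGroups

/-! ## Trees of fusion systems -/

/-- A tree of `p`-fusion systems `(T, F, S)`: a tree of finite `p`-groups `(T, S)` with fusion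
systems `F(v)` on `S(v)` and `F(e)` on `S(e)`, for which the monomorphisms `S(e) → S(v)` are
injective morphisms of fusion systems. (Finiteness and being a `p`-group are part of
`FusionSystem`.) -/
structure TreeOfFusionSystems (p : ℕ) {V : Type w} (T : SimpleGraph V) where
  S : TreeOfGroups.{w, u} T
  vertSys : ∀ v, FusionSystem p (S.vert v)
  edgeSys : ∀ e, FusionSystem p (S.edge e)
  map_isInjectiveMorphism : ∀ e v hv,
    (edgeSys e).IsInjectiveMorphism (vertSys v) (S.map e v hv)

namespace TreeOfFusionSystems

/-- Hypothesis (H) with respect to the vertex `vstar`: for each vertex `v`, if `e` is the edge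
incident to `v` in the unique path from `v` to `vstar`, then `S(e) ≅ S(v)`.
(There is no such edge when `v = vstar`.) -/
def SatisfiesH {p : ℕ} {V : Type w} {T : SimpleGraph V} (𝓕 : TreeOfFusionSystems.{w, u} p T)
    (vstar : V) : Prop :=
  ∀ (v : V) (q : T.Path v vstar) (e : T.edgeSet), v ∈ (e : Sym2 V) →
    (e : Sym2 V) ∈ (q : T.Walk v vstar).edges → Nonempty (𝓕.S.edge e ≃* 𝓕.S.vert v)

/-- A cocone, in the category of `p`-fusion systems, on the diagram given by a tree of fusion
systems. -/
structure Cocone {p : ℕ} {V : Type w} {T : SimpleGraph V} (𝓕 : TreeOfFusionSystems.{w, u} p T)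
    where
  carrier : Type u
  [group : Group carrier]
  sys : FusionSystem p carrier
  legV : ∀ v, 𝓕.S.vert v →* carrier
  legE : ∀ e, 𝓕.S.edge e →* carrier
  legV_isMorphism : ∀ v, (𝓕.vertSys v).IsMorphism sys (legV v)
  legE_isMorphism : ∀ e, (𝓕.edgeSys e).IsMorphism sys (legE e)
  comm : ∀ e v hv, (legV v).comp (𝓕.S.map e v hv) = legE e

attribute [instance] Cocone.group

/-- A completion of a tree of fusion systems is a colimit of the diagram, i.e. a universal
cocone. -/
def Cocone.IsCompletion {p : ℕ} {V : Type w} {T : SimpleGraph V}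
    {𝓕 : TreeOfFusionSystems.{w, u} p T} (C : 𝓕.Cocone) : Prop :=
  ∀ D : 𝓕.Cocone, ∃! ψ : C.carrier →* D.carrier, C.sys.IsMorphism D.sys ψ ∧
    (∀ v, ψ.comp (C.legV v) = D.legV v) ∧ (∀ e, ψ.comp (C.legE e) = D.legE e)

end TreeOfFusionSystems

/-! ## Trees of fusion systems induced by trees of finite groups -/

/-- The choices made in forming a tree of fusion systems induced by a tree of groups: Sylow
`p`-subgroups `S(v)` of `G(v)` and `S(e)` of `G(e)`, and elements `g_{ev}` of `G(v)` for which
the conjugate by `g_{ev}` of the image of `S(e)` lies in `S(v)`. -/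
structure SylowChoice (p : ℕ) {V : Type w} {T : SimpleGraph V} (𝒢 : TreeOfGroups.{w, u} T) where
  sylV : ∀ v, Sylow p (𝒢.vert v)
  sylE : ∀ e, Sylow p (𝒢.edge e)
  g : ∀ (e : T.edgeSet) (v : V), v ∈ (e : Sym2 V) → 𝒢.vert v
  conj_mem : ∀ e v hv, ∀ x ∈ sylE e, (g e v hv)⁻¹ * 𝒢.map e v hv x * g e v hv ∈ sylV v

namespace SylowChoice

/-- The monomorphism `S(e) → S(v)`: the map `G(e) → G(v)` followed by conjugation by `g_{ev}`. -/
def map {p : ℕ} {V : Type w} {T : SimpleGraph V} {𝒢 : TreeOfGroups.{w, u} T}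
    (c : SylowChoice p 𝒢) (e : T.edgeSet) (v : V) (hv : v ∈ (e : Sym2 V)) :
    (c.sylE e : Subgroup (𝒢.edge e)) →* (c.sylV v : Subgroup (𝒢.vert v)) where
  toFun x := ⟨(c.g e v hv)⁻¹ * 𝒢.map e v hv x * c.g e v hv, c.conj_mem e v hv x x.2⟩
  map_one' := by ext; simp
  map_mul' a b := by ext; simp [mul_assoc]

theorem map_injective {p : ℕ} {V : Type w} {T : SimpleGraph V} {𝒢 : TreeOfGroups.{w, u} T}
    (c : SylowChoice p 𝒢) (e : T.edgeSet) (v : V) (hv : v ∈ (e : Sym2 V)) :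
    Function.Injective (c.map e v hv) := by
  intro x y h
  have h' := congrArg Subtype.val h
  simp only [map, MonoidHom.coe_mk, OneHom.coe_mk, mul_left_inj, mul_right_inj] at h'
  exact Subtype.ext (𝒢.map_injective e v hv h')

theorem map_isInjectiveMorphism {p : ℕ} {V : Type w} {T : SimpleGraph V}
    {𝒢 : TreeOfGroups.{w, u} T} (c : SylowChoice p 𝒢) (e : T.edgeSet) (v : V)
    (hv : v ∈ (e : Sym2 V)) (h₁ : Finite (c.sylE e : Subgroup (𝒢.edge e)))
    (h₂ : IsPGroup p (c.sylE e : Subgroup (𝒢.edge e)))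
    (h₃ : Finite (c.sylV v : Subgroup (𝒢.vert v)))
    (h₄ : IsPGroup p (c.sylV v : Subgroup (𝒢.vert v))) :
    (FusionSystem.ofGroup _ h₁ h₂).IsInjectiveMorphism (FusionSystem.ofGroup _ h₃ h₄)
      (c.map e v hv) := by
  refine ⟨?_, ?_⟩
  · rintro P Q α ⟨h, hα⟩
    have key : ∀ x : P, (c.map e v hv (α x) : 𝒢.vert v) =
        ((c.g e v hv)⁻¹ * 𝒢.map e v hv h * c.g e v hv)⁻¹ * (c.map e v hv x : 𝒢.vert v) *
          ((c.g e v hv)⁻¹ * 𝒢.map e v hv h * c.g e v hv) := by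
      intro x
      simp [map, hα, mul_assoc]
    refine ⟨FusionSystem.conjHom ((c.g e v hv)⁻¹ * 𝒢.map e v hv h * c.g e v hv) ?_,
      ⟨_, fun x => rfl⟩, ?_⟩
    · rintro _ ⟨x, hx, rfl⟩
      exact ⟨_, ⟨α ⟨x, hx⟩, (α ⟨x, hx⟩).2, rfl⟩, key ⟨x, hx⟩⟩
    · ext x
      exact key x
  · intro P α _ α' _ hαα'
    ext x
    have h := congrArg Subtype.val (DFunLike.congr_fun hαα' x)
    exact congrArg (fun y => ((y : (c.sylE e : Subgroup (𝒢.edge e))) : 𝒢.edge e))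
      (c.map_injective e v hv h)

/-- The tree of finite `p`-groups `(T, S)`. -/
def treeOfPGroups {p : ℕ} {V : Type w} {T : SimpleGraph V} {𝒢 : TreeOfGroups.{w, u} T}
    (c : SylowChoice p 𝒢) : TreeOfGroups.{w, u} T where
  isTree := 𝒢.isTree
  vert v := (c.sylV v : Subgroup (𝒢.vert v))
  edge e := (c.sylE e : Subgroup (𝒢.edge e))
  map := c.map
  map_injective := c.map_injective

/-- The tree of fusion systems induced by a tree of finite groups: `F(v) = F_{S(v)}(G(v))` and
`F(e) = F_{S(e)}(G(e))`. -/
def inducedTree {p : ℕ} {V : Type w} {T : SimpleGraph V} {𝒢 : TreeOfGroups.{w, u} T}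
    [h𝒢 : 𝒢.IsFinite] (c : SylowChoice p 𝒢) : TreeOfFusionSystems.{w, u} p T where
  S := c.treeOfPGroups
  vertSys v := FusionSystem.ofGroup (c.sylV v : Subgroup (𝒢.vert v))
    (haveI := h𝒢.vert v; inferInstance) (c.sylV v).isPGroup'
  edgeSys e := FusionSystem.ofGroup (c.sylE e : Subgroup (𝒢.edge e))
    (haveI := h𝒢.edge e; inferInstance) (c.sylE e).isPGroup'
  map_isInjectiveMorphism e v hv := c.map_isInjectiveMorphism e v hv _ _ _ _

/-- The monomorphism of `S(v) ≤ G(v)` into the completion `G_T`. -/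
def toCompletion {p : ℕ} {V : Type w} {T : SimpleGraph V} {𝒢 : TreeOfGroups.{w, u} T}
    (c : SylowChoice p 𝒢) (v : V) : (c.sylV v : Subgroup (𝒢.vert v)) →* 𝒢.completion :=
  (𝒢.toCompletion v).comp (c.sylV v : Subgroup (𝒢.vert v)).subtype

/-- `S(v)` as a subgroup of the completion `G_T`. -/
def image {p : ℕ} {V : Type w} {T : SimpleGraph V} {𝒢 : TreeOfGroups.{w, u} T}
    (c : SylowChoice p 𝒢) (v : V) : Subgroup 𝒢.completion :=
  (c.toCompletion v).range

/-- The fusion system `F_{S(v)}(G_T)`. -/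
def completionFusion {p : ℕ} {V : Type w} {T : SimpleGraph V} {𝒢 : TreeOfGroups.{w, u} T}
    [h𝒢 : 𝒢.IsFinite] (c : SylowChoice p 𝒢) (v : V) : FusionSystem p (c.image v) :=
  FusionSystem.ofGroup (c.image v)
    (haveI := h𝒢.vert v; Finite.of_surjective _ (c.toCompletion v).rangeRestrict_surjective)
    (IsPGroup.of_surjective (c.sylV v).isPGroup' (c.toCompletion v).rangeRestrict
      (c.toCompletion v).rangeRestrict_surjective)

end SylowChoice

/-!
The completion `G_T` acts on the Bass–Serre tree, whose vertices over `v` are the cosets of `G(v)`,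
and everything is read off from fixed points of finite subgroups.

* The vertex groups embed in `G_T` (`TreeOfGroups.toCompletion_injective`), as they have
  free actions on `ℕ` which agree on the edge groups.
* The Bass–Serre graph is a tree (`TreeOfGroups.isTree_bassSerre`), and in `G_T` the groups at the
  ends of an edge `e` intersect in `G(e)`. Both facts follow from functions which change
  their value along a single edge; these come from an action of `G_T` on a double cover of itself
  (`TreeOfGroups.exists_separation`), and no normal form for the elements of `G_T` is needed.
* A finite group acting on a tree without inversions fixes a vertex, so a finite `p`-subgroup of
  `G_T` is conjugate into some `G(v)`, hence into some `S(v)`. By (H) the maps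
  `S(v) ≅ S(e) → S(w)` along the path from `v` to `v_*` compose to a map `S(v) → S(v_*)` which is a
  conjugation in `G_T` (`SylowChoice.exists_map_root`). So `S(v_*)` is a Sylow `p`-subgroup.
* These maps make `F_{S(v_*)}(G_T)` a cocone. It is universal: if `g` conjugates `P ≤ S(v_*)` into
  `S(v_*)`, then `P` fixes the vertices `G(v_*)` and `gG(v_*)` of the Bass–Serre tree, hence the
  path between them, along which the conjugation decomposes into morphisms of the `F(v)` and transfers
  through the `S(e)`; every cocone respects these (`SylowChoice.related_of_walk`).

Independence of the choices holds because Sylow `p`-subgroups of `G_T` are conjugate.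
-/

/-! ### Trees -/

namespace SimpleGraph

/-- Two adjacent vertices of a tree are consecutive on the path from one of them to the root. -/
theorem IsTree.isPath_cons_or_isPath_cons {V : Type*} {T : SimpleGraph V} (hT : T.IsTree)
    {r v w : V} (h : T.Adj v w) {p : T.Walk v r} {q : T.Walk w r} (hp : p.IsPath)
    (hq : q.IsPath) : p = Walk.cons h q ∨ q = Walk.cons h.symm p := by
  classical
  by_cases hv : v ∈ q.support
  · right
    have h1 : q.takeUntil v hv = Walk.cons h.symm Walk.nil :=
      (hT.existsUnique_path w v).unique (hq.takeUntil hv) (by simp [h.ne'])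
    have h2 : q.dropUntil v hv = p := (hT.existsUnique_path v r).unique (hq.dropUntil hv) hp
    rw [← q.take_spec hv, h1, h2]
    simp
  · left
    exact (hT.existsUnique_path v r).unique hp (hq.cons hv)

/-- Transport of a value backwards along a walk, by a rule for each step. -/
def Walk.transport {V : Type*} {T : SimpleGraph V} {A : V → Type*}
    (next : ∀ v w, T.Adj v w → A w → A v) : ∀ {v r : V}, T.Walk v r → A r → A v
  | _, _, .nil, a => a
  | _, _, .cons h q, a => next _ _ h (q.transport next a)

/-- Data on the vertices of a tree can be chosen outwards from the root, compatibly along edges: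
an extension is needed only from a vertex to its neighbours further away from the root. -/
theorem IsTree.exists_family {V : Type*} {T : SimpleGraph V} (hT : T.IsTree) (r : V)
    {A : V → Type*} (R : ∀ v w, A v → A w → Prop) (hR : ∀ v w a b, R v w a b → R w v b a)
    (a₀ : A r)
    (step : ∀ (v w : V) (h : T.Adj v w) (q : T.Walk w r), (Walk.cons h q).IsPath →
      ∀ a : A w, ∃ b : A v, R v w b a) :
    ∃ f : ∀ v, A v, f r = a₀ ∧ ∀ v w, T.Adj v w → R v w (f v) (f w) := by
  classical
  have hne : ∀ {v r' : V} (p : T.Walk v r'), r' = r → p.IsPath → Nonempty (A v) := by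
    intro v r' p
    induction p with
    | nil => rintro rfl _; exact ⟨a₀⟩
    | cons h q ih =>
      rintro rfl hp
      obtain ⟨a⟩ := ih rfl hp.of_cons
      exact ⟨(step _ _ h q hp a).choose⟩
  choose p hp _ using fun v => hT.existsUnique_path v r
  have hne' : ∀ v, Nonempty (A v) := fun v => hne (p v) rfl (hp v)
  let next : ∀ v w, T.Adj v w → A w → A v := fun v w _ a => Classical.epsilon fun b => R v w b a
  let F : ∀ v, A v := fun v => (p v).transport next a₀
  have hcons : ∀ v w (h : T.Adj v w), p v = Walk.cons h (p w) → R v w (F v) (F w) := by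
    intro v w h e
    have : F v = next v w h (F w) := by simp only [F, e, Walk.transport]
    rw [this]
    exact Classical.epsilon_spec (step v w h (p w) (e ▸ hp v) (F w))
  refine ⟨F, ?_, fun v w h => ?_⟩
  · have : p r = Walk.nil := (hT.existsUnique_path r r).unique (hp r) Walk.IsPath.nil
    simp only [F, this, Walk.transport]
  · rcases hT.isPath_cons_or_isPath_cons h (hp v) (hp w) with e | e
    · exact hcons v w h e
    · exact hR _ _ _ _ (hcons w v h.symm e)

/-- If `z` is the second vertex of a path from `x` to a vertex `y` at distance at least two, then
any given vertex `a` is closer to `z` than to the farther of `x` and `y`: a vertex `a` on the side of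
`x` of the edge `xz` is separated from `y` by this edge. -/
theorem IsTree.dist_lt_max_of_adj {X : Type*} {T : SimpleGraph X} (hT : T.IsTree) {x y z : X}
    (h : T.Adj x z) {p : T.Walk z y} (hp : (Walk.cons h p).IsPath) (hy : ¬ T.dist x y ≤ 1)
    (a : X) : T.dist z a < max (T.dist x a) (T.dist y a) := by
  classical
  obtain ⟨q, hq, hqd⟩ := hT.connected.exists_path_of_dist x a
  by_cases hz : z ∈ q.support
  · refine lt_max_of_lt_left ?_
    have h1 : q.takeUntil z hz = Walk.cons h Walk.nil :=
      (hT.existsUnique_path x z).unique (hq.takeUntil hz) (by simp [h.ne])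
    have h2 := congrArg Walk.length (q.take_spec hz)
    rw [h1, Walk.length_append, hqd] at h2
    have h3 := T.dist_le (q.dropUntil z hz)
    simp only [Walk.length_cons, Walk.length_nil] at h2
    omega
  · refine lt_max_of_lt_right ?_
    rw [Walk.cons_isPath_iff] at hp
    have hb := isAcyclic_iff_forall_adj_isBridge.1 hT.isAcyclic h
    rw [isBridge_iff] at hb
    have hxa : (T.deleteEdges {s(x, z)}).Reachable x a :=
      reachable_deleteEdges_iff_exists_walk.2
        ⟨q, fun hm => hz (q.snd_mem_support_of_mem_edges hm)⟩
    have hzy : (T.deleteEdges {s(x, z)}).Reachable z y :=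
      reachable_deleteEdges_iff_exists_walk.2
        ⟨p, fun hm => hp.2 (p.fst_mem_support_of_mem_edges hm)⟩
    obtain ⟨r, hr, hrd⟩ := hT.connected.exists_path_of_dist y a
    have hm := r.mem_edges_of_not_reachable_deleteEdges
      (fun hya => hb (hxa.trans (hya.symm.trans hzy.symm)))
    have hx := r.fst_mem_support_of_mem_edges hm
    have h2 := congrArg Walk.length (r.take_spec hx)
    rw [Walk.length_append, hrd] at h2
    have h3 := T.dist_le (r.dropUntil x hx)
    have h4 := T.dist_le (r.takeUntil x hx)
    have h5 := hT.connected.dist_triangle (u := z) (v := x) (w := a)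
    have h6 : T.dist z x = 1 := dist_eq_one_iff_adj.2 h.symm
    have h7 := T.dist_comm (u := x) (v := y)
    omega

/-- A finite group acting on a tree by automorphisms has a fixed vertex, provided that no vertex is
moved to a neighbour. The vertices which minimise the largest distance to an orbit are pairwise
at distance at most one, and they are permuted by the group. -/
theorem IsTree.exists_fixed_of_finite {X K : Type*} [Group K] [Finite K] [MulAction K X]
    {T : SimpleGraph X} (hT : T.IsTree) (hadj : ∀ (k : K) x y, T.Adj x y → T.Adj (k • x) (k • y))
    (hinv : ∀ (k : K) x, ¬ T.Adj x (k • x)) : ∃ x : X, ∀ k : K, k • x = x := by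
  classical
  have := Fintype.ofFinite K
  have := hT.connected.nonempty
  let x₀ : X := Classical.arbitrary X
  have hdist_le : ∀ (k : K) x y, T.dist (k • x) (k • y) ≤ T.dist x y := by
    intro k x y
    obtain ⟨p, hp⟩ := hT.connected.exists_walk_length_eq_dist x y
    let f : T →g T := ⟨fun x => k • x, fun h => hadj k _ _ h⟩
    rw [← hp, ← Walk.length_map f p]
    exact T.dist_le (p.map f)
  have hdist : ∀ (k : K) x y, T.dist (k • x) (k • y) = T.dist x y := by
    intro k x y
    refine le_antisymm (hdist_le k x y) ?_
    simpa using hdist_le k⁻¹ (k • x) (k • y)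
  let F : X → ℕ := fun x => Finset.univ.sup fun k : K => T.dist x (k • x₀)
  have hF : ∀ k x, T.dist x (k • x₀) ≤ F x := fun k x =>
    Finset.le_sup (f := fun k : K => T.dist x (k • x₀)) (Finset.mem_univ k)
  have hFle : ∀ (k : K) x, F (k • x) ≤ F x := by
    intro k x
    refine Finset.sup_le fun l _ => ?_
    have := hdist k x ((k⁻¹ * l) • x₀)
    rw [smul_smul, mul_inv_cancel_left] at this
    rw [this]
    exact hF _ _
  obtain ⟨x, hx⟩ : ∃ x, ∀ y, F x ≤ F y :=
    ⟨Function.argmin F, fun y => Function.argmin_le F y⟩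
  refine ⟨x, fun k => ?_⟩
  by_contra hne
  obtain ⟨p, hp, hpd⟩ := hT.connected.exists_path_of_dist x (k • x)
  have hd := hT.connected.one_lt_dist_of_ne_of_not_adj (Ne.symm hne) (hinv k x)
  have hle := hFle k x
  generalize k • x = y at p hp hne hd hle
  cases p with
  | nil => exact hne rfl
  | @cons _ z _ h q =>
    have hlt : ∀ l : K, T.dist z (l • x₀) < F x := fun l =>
      (hT.dist_lt_max_of_adj h hp hd.not_ge (l • x₀)).trans_le
        (max_le (hF l x) ((hF l y).trans hle))
    -- `z` contradicts the minimality of `F x`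
    have : F z < F x := by
      refine (Finset.sup_lt_iff ?_).2 fun l _ => hlt l
      exact (Nat.zero_le _).trans_lt (hlt 1)
    exact absurd (hx z) (not_le.2 this)

/-- The path between two fixed vertices of a tree automorphism consists of fixed vertices. -/
theorem IsTree.fixed_of_mem_support {X : Type*} {T : SimpleGraph X} (hT : T.IsTree)
    (f : T →g T) (hf : Function.Injective f) {x y : X} (hx : f x = x) (hy : f y = y)
    {p : T.Walk x y} (hp : p.IsPath) : ∀ z ∈ p.support, f z = z := by
  have h : ((p.map f).copy hx hy) = p :=
    (hT.existsUnique_path x y).unique (by simpa using hp.map hf) hp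
  have h' := congrArg Walk.support h
  rw [Walk.support_copy, Walk.support_map] at h'
  exact fun z hz => List.map_inj_left.1 (h'.trans (List.map_id _).symm) z hz

end SimpleGraph

/-! ### Faithful representations of the completion -/

/-- A permutation representation is free if no nontrivial element has a fixed point. -/
def MonoidHom.IsFreeAction {H : Type*} [Group H] {X : Type*} (ρ : H →* Equiv.Perm X) : Prop :=
  ∀ h x, ρ h x = x → h = 1

/-- A free action of a finite group on `ℕ` is isomorphic to the action on `H × ℕ` by left
multiplication. -/
theorem MonoidHom.IsFreeAction.exists_equiv {H : Type*} [Group H] [Finite H]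
    {ρ : H →* Equiv.Perm ℕ} (hρ : ρ.IsFreeAction) :
    ∃ σ : H × ℕ ≃ ℕ, ∀ h x, σ (h * x.1, x.2) = ρ h (σ x) := by
  let _ : MulAction H ℕ := MulAction.compHom ℕ ρ
  have hsmul : ∀ (h : H) (n : ℕ), h • n = ρ h n := fun _ _ => rfl
  let Ω := MulAction.orbitRel.Quotient H ℕ
  let f : H × Ω → ℕ := fun x => x.1 • x.2.out
  have hf : Function.Bijective f := by
    constructor
    · rintro ⟨h, a⟩ ⟨k, b⟩ e
      simp only [f] at e
      have hab : a = b := by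
        rw [← Quotient.out_eq a, ← Quotient.out_eq b]
        refine Quotient.sound (MulAction.orbitRel_apply.2 ⟨h⁻¹ * k, ?_⟩)
        simp only [mul_smul, ← e, inv_smul_smul]
      subst hab
      have : k⁻¹ * h = 1 := hρ _ a.out (by rw [← hsmul, mul_smul, e, inv_smul_smul])
      rw [inv_mul_eq_one.1 this]
    · intro n
      have : MulAction.orbitRel H ℕ n (Quotient.out (Quotient.mk _ n : Ω)) :=
        Quotient.exact (Quotient.out_eq (Quotient.mk _ n : Ω)).symm
      obtain ⟨h, hh⟩ := MulAction.orbitRel_apply.1 this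
      exact ⟨(h, _), hh⟩
  have : Infinite Ω := by
    refine not_finite_iff_infinite.1 fun _ => ?_
    exact not_finite_iff_infinite.2 inferInstance (Finite.of_surjective f hf.2)
  have : Countable Ω := by
    refine Function.Surjective.countable (f := (Quotient.mk _ : ℕ → Ω)) Quotient.mk_surjective
  obtain ⟨τ⟩ : Nonempty (ℕ ≃ Ω) := nonempty_equiv_of_countable
  refine ⟨((Equiv.refl H).prodCongr τ).trans (Equiv.ofBijective f hf), fun h x => ?_⟩
  simp [f, ← hsmul, mul_smul]

theorem exists_isFreeAction (H : Type*) [Group H] [Finite H] :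
    ∃ ρ : H →* Equiv.Perm ℕ, ρ.IsFreeAction := by
  have : Countable H := Finite.to_countable
  obtain ⟨τ⟩ : Nonempty (H × ℕ ≃ ℕ) := nonempty_equiv_of_countable
  refine ⟨{ toFun := fun h => (τ.symm.trans ((Equiv.mulLeft h).prodCongr (.refl ℕ))).trans τ
            map_one' := by ext; simp
            map_mul' := fun a b => by ext; simp [Prod.map] }, fun h n e => ?_⟩
  have := congrArg (fun m => (τ.symm m).1) e
  simpa using this

/-- Any two free actions of a finite group on `ℕ` are isomorphic. -/
theorem MonoidHom.IsFreeAction.exists_conj {H : Type*} [Group H] [Finite H]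
    {ρ ρ' : H →* Equiv.Perm ℕ} (hρ : ρ.IsFreeAction) (hρ' : ρ'.IsFreeAction) :
    ∃ σ : Equiv.Perm ℕ, ∀ h, σ * ρ h * σ⁻¹ = ρ' h := by
  obtain ⟨τ, hτ⟩ := hρ.exists_equiv
  obtain ⟨τ', hτ'⟩ := hρ'.exists_equiv
  refine ⟨τ.symm.trans τ', fun h => ?_⟩
  ext n
  obtain ⟨x, rfl⟩ := τ'.surjective n
  simp [Equiv.Perm.mul_apply, Equiv.Perm.inv_def, ← hτ, ← hτ']

namespace TreeOfGroups

variable {V : Type w} {T : SimpleGraph V} (𝒢 : TreeOfGroups.{w, u} T)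

/-- The vertex groups embed in the completion. They act freely on `ℕ`, and as free actions of an
edge group are unique up to isomorphism, the actions can be chosen to agree on the edge groups. -/
theorem toCompletion_injective [h𝒢 : 𝒢.IsFinite] (r : V) :
    Function.Injective (𝒢.toCompletion r) := by
  have := h𝒢.vert
  have := h𝒢.edge
  obtain ⟨ρ₀, hρ₀⟩ := exists_isFreeAction (𝒢.vert r)
  obtain ⟨ρ, -, hρ⟩ := 𝒢.isTree.exists_family r
    (A := fun v => {ρ : 𝒢.vert v →* Equiv.Perm ℕ // ρ.IsFreeAction})
    (fun v w ρ ρ' => ∀ (e : T.edgeSet) (hv : v ∈ (e : Sym2 V)) (hw : w ∈ (e : Sym2 V)) x,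
      ρ.1 (𝒢.map e v hv x) = ρ'.1 (𝒢.map e w hw x))
    (fun v w a b h e hv hw x => (h e hw hv x).symm) ⟨ρ₀, hρ₀⟩ (by
      rintro v w h - - ⟨ρ', hρ'⟩
      obtain ⟨ρ, hρ⟩ := exists_isFreeAction (𝒢.vert v)
      let e₀ : T.edgeSet := ⟨s(v, w), h⟩
      have hv₀ : v ∈ (e₀ : Sym2 V) := Sym2.mem_mk_left _ _
      have hw₀ : w ∈ (e₀ : Sym2 V) := Sym2.mem_mk_right _ _
      obtain ⟨σ, hσ⟩ := MonoidHom.IsFreeAction.exists_conj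
        (ρ := ρ.comp (𝒢.map e₀ v hv₀)) (ρ' := ρ'.comp (𝒢.map e₀ w hw₀))
        (fun x n e => 𝒢.map_injective e₀ v hv₀ ((hρ _ n e).trans (map_one _).symm))
        (fun x n e => 𝒢.map_injective e₀ w hw₀ ((hρ' _ n e).trans (map_one _).symm))
      refine ⟨⟨(MulAut.conj σ).toMonoidHom.comp ρ, fun x n e => hρ x (σ⁻¹ n) ?_⟩, ?_⟩
      · simpa [Equiv.Perm.mul_apply, ← Equiv.Perm.eq_inv_iff_eq] using e
      · intro e hv hw x
        obtain rfl : e = e₀ := Subtype.ext ((Sym2.mem_and_mem_iff h.ne).1 ⟨hv, hw⟩)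
        exact hσ x)
  obtain ⟨F, hF, -⟩ := 𝒢.existsUnique_lift (fun v => (ρ v).1) (by
    intro e v w hv hw
    ext1 x
    by_cases hvw : v = w
    · subst hvw; rfl
    · have he := (Sym2.mem_and_mem_iff hvw).1 ⟨hv, hw⟩
      exact hρ v w (by rw [← SimpleGraph.mem_edgeSet, ← he]; exact e.2) e hv hw x)
  refine (injective_iff_map_eq_one _).2 fun x hx => (ρ r).2 x 0 ?_
  have := DFunLike.congr_fun (hF r) x
  rw [MonoidHom.comp_apply, hx, map_one] at this
  rw [← this, Equiv.Perm.one_apply]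

end TreeOfGroups

/-! ### The Bass–Serre tree -/

namespace TreeOfGroups

variable {V : Type w} {T : SimpleGraph V} (𝒢 : TreeOfGroups.{w, u} T)

/-- The completion is generated by the vertex groups. -/
theorem completion_induction {P : 𝒢.completion → Prop} (one : P 1)
    (mul : ∀ v (g : 𝒢.vert v) x, P x → P (𝒢.toCompletion v g * x)) (x : 𝒢.completion) : P x := by
  obtain ⟨y, rfl⟩ := QuotientGroup.mk'_surjective _ x
  induction y using Monoid.CoprodI.induction_left with
  | one => exact one
  | mul m y ih => exact mul _ m _ ih

/-- The image of the edge group `G(e)` in the completion, by way of an end of `e`. -/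
def edgeImage (e : T.edgeSet) (v : V) (hv : v ∈ (e : Sym2 V)) : Subgroup 𝒢.completion :=
  ((𝒢.toCompletion v).comp (𝒢.map e v hv)).range

theorem edgeImage_eq (e : T.edgeSet) (v w : V) (hv : v ∈ (e : Sym2 V)) (hw : w ∈ (e : Sym2 V)) :
    𝒢.edgeImage e v hv = 𝒢.edgeImage e w hw := by
  unfold edgeImage
  congr 1
  ext x
  exact 𝒢.toCompletion_map e v w hv hw x

theorem edgeImage_le (e : T.edgeSet) (v : V) (hv : v ∈ (e : Sym2 V)) :
    𝒢.edgeImage e v hv ≤ (𝒢.toCompletion v).range := by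
  rintro _ ⟨x, rfl⟩
  exact ⟨_, rfl⟩

/-- A function on the vertices of the Bass–Serre tree, given by functions `f v` on the completion
invariant under `G(v)`, which changes its value along one edge only, the coset `G(e₀)`.

With `b` the indicator function of `G(e₀)` and `δ v` equal to `0` on one side of `e₀` and to `b` on
the other, the regular action of `G(v)` on `G_T`, lifted to the double cover `G_T × ℤ/2` and twisted
by `δ v`, agrees on edge groups, as `b` is invariant under `G(e₀)`. So the completion acts on
`G_T × ℤ/2`, and the orbit of `(1, 0)` yields the function. -/
theorem exists_separation (e₀ : T.edgeSet) {v₀ w₀ : V} (hv₀ : v₀ ∈ (e₀ : Sym2 V))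
    (hw₀ : w₀ ∈ (e₀ : Sym2 V)) (hne : v₀ ≠ w₀) :
    ∃ f : V → 𝒢.completion → ZMod 2,
      (∀ v g x, f v (x * 𝒢.toCompletion v g) = f v x) ∧
      (∀ v w, T.Adj v w → s(v, w) ≠ e₀ → f v = f w) ∧
      (∀ x ∈ 𝒢.edgeImage e₀ v₀ hv₀, f v₀ x ≠ f w₀ x) ∧
      ∀ x ∉ 𝒢.edgeImage e₀ v₀ hv₀, f v₀ x = f w₀ x := by
  classical
  have he₀ := (Sym2.mem_and_mem_iff hne).1 ⟨hv₀, hw₀⟩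
  let b : 𝒢.completion → ZMod 2 := fun x => if x ∈ 𝒢.edgeImage e₀ v₀ hv₀ then 1 else 0
  have hb : ∀ x, ∀ k ∈ 𝒢.edgeImage e₀ v₀ hv₀, b (x * k) = b x := by
    intro x k hk
    simp only [b, Subgroup.mul_mem_cancel_right _ hk]
  let δ : V → 𝒢.completion → ZMod 2 := fun v =>
    if (T.deleteEdges {(e₀ : Sym2 V)}).Reachable v₀ v then 0 else b
  have hδv₀ : δ v₀ = 0 := if_pos (SimpleGraph.Reachable.refl _)
  have hδw₀ : δ w₀ = b := by
    have hadj : T.Adj v₀ w₀ := by rw [← SimpleGraph.mem_edgeSet, ← he₀]; exact e₀.2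
    have := SimpleGraph.isAcyclic_iff_forall_adj_isBridge.1 𝒢.isTree.isAcyclic hadj
    rw [SimpleGraph.isBridge_iff, ← he₀] at this
    exact if_neg this
  have hδ : ∀ v w, T.Adj v w → s(v, w) ≠ e₀ → δ v = δ w := by
    intro v w h hne
    have h' : (T.deleteEdges {(e₀ : Sym2 V)}).Adj v w := by simpa using ⟨h, hne⟩
    have : (T.deleteEdges {(e₀ : Sym2 V)}).Reachable v₀ v ↔
        (T.deleteEdges {(e₀ : Sym2 V)}).Reachable v₀ w :=
      ⟨fun k => k.trans h'.reachable, fun k => k.trans h'.reachable.symm⟩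
    simp only [δ, this]
  have hδinv : ∀ v x, ∀ k ∈ 𝒢.edgeImage e₀ v₀ hv₀, δ v (x * k) = δ v x := by
    intro v x k hk
    by_cases h : (T.deleteEdges {(e₀ : Sym2 V)}).Reachable v₀ v
    · simp only [δ, if_pos h, Pi.zero_apply]
    · simp only [δ, if_neg h, hb x k hk]
  have two : ∀ a b : ZMod 2, a + b + b = a := by decide
  let ρ : ∀ v, 𝒢.vert v →* Equiv.Perm (𝒢.completion × ZMod 2) := fun v => MonoidHom.toHomPerm
    { toFun := fun g y => (y.1 * (𝒢.toCompletion v g)⁻¹,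
        y.2 + δ v y.1 + δ v (y.1 * (𝒢.toCompletion v g)⁻¹))
      map_one' := by
        funext y
        change _ = y
        simp [two]
      map_mul' := fun g h => by
        funext y
        change _ = (_ * _ * _, _ + δ v _ + δ v _ + δ v _ + δ v _)
        simp [two, mul_assoc] }
  have hρ : ∀ v g y, ρ v g y = (y.1 * (𝒢.toCompletion v g)⁻¹,
      y.2 + δ v y.1 + δ v (y.1 * (𝒢.toCompletion v g)⁻¹)) := fun _ _ _ => rfl
  obtain ⟨F, hF, -⟩ := 𝒢.existsUnique_lift ρ (by
    intro e v w hv hw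
    ext1 k
    ext1 y
    simp only [MonoidHom.comp_apply, hρ, 𝒢.toCompletion_map e v w hv hw k]
    by_cases hvw : v = w
    · subst hvw; rfl
    have he := (Sym2.mem_and_mem_iff hvw).1 ⟨hv, hw⟩
    by_cases hee : e = e₀
    · subst hee
      have hk : (𝒢.toCompletion w (𝒢.map e w hw k))⁻¹ ∈ 𝒢.edgeImage e v₀ hv₀ := by
        rw [𝒢.edgeImage_eq e v₀ w hv₀ hw]
        exact inv_mem ⟨k, rfl⟩
      rw [hδinv v _ _ hk, hδinv w _ _ hk, two, two]
    · rw [hδ v w (by rw [← SimpleGraph.mem_edgeSet, ← he]; exact e.2)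
        (fun h => hee (Subtype.ext (he.trans h)))])
  have hF' : ∀ v g, F (𝒢.toCompletion v g) = ρ v g := fun v g => DFunLike.congr_fun (hF v) g
  have hF1 : ∀ x y, (F x y).1 = y.1 * x⁻¹ := by
    intro x
    induction x using 𝒢.completion_induction with
    | one => simp
    | mul v g x ih =>
      intro y
      rw [map_mul, Equiv.Perm.mul_apply, hF', hρ, ih, mul_inv_rev, mul_assoc]
  refine ⟨fun v x => (F x⁻¹ (1, 0)).2 + δ v x, ?_, ?_, ?_, ?_⟩
  · intro v g x
    dsimp only
    rw [mul_inv_rev, map_mul, Equiv.Perm.mul_apply, ← map_inv, hF', hρ, hF1, map_inv]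
    simp [two]
  · intro v w h hne
    simp only [hδ v w h hne]
  · intro x hx
    simp [hδv₀, hδw₀, b, hx]
  · intro x hx
    simp [hδv₀, hδw₀, b, hx]

/-- In the completion, `G(v)` and `G(w)` intersect in `G(e)`, for an edge `e` with ends `v`, `w`. -/
theorem inf_range_le_edgeImage (e : T.edgeSet) {v w : V} (hv : v ∈ (e : Sym2 V))
    (hw : w ∈ (e : Sym2 V)) (hne : v ≠ w) :
    (𝒢.toCompletion v).range ⊓ (𝒢.toCompletion w).range ≤ 𝒢.edgeImage e v hv := by
  obtain ⟨f, hf, -, hf1, hf2⟩ := 𝒢.exists_separation e hv hw hne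
  rintro z ⟨⟨g, rfl⟩, ⟨h, hh⟩⟩
  by_contra hz
  have h1 := hf v g 1
  have h2 := hf w h 1
  rw [one_mul] at h1 h2
  rw [hh, ← hf2 _ hz, h1] at h2
  exact hf1 1 (one_mem _) h2

/-- The Bass–Serre tree: its vertices over `v` are the cosets of `G(v)` in the completion, and
`gG(v)`, `gG(w)` are joined by an edge if `v` and `w` are. -/
def bassSerre : SimpleGraph (Σ v, 𝒢.completion ⧸ (𝒢.toCompletion v).range) where
  Adj x y := T.Adj x.1 y.1 ∧ ∃ g : 𝒢.completion, x.2 = QuotientGroup.mk g ∧ y.2 = QuotientGroup.mk g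
  symm := ⟨fun _ _ ⟨h, g, h₁, h₂⟩ => ⟨h.symm, g, h₂, h₁⟩⟩
  loopless := ⟨fun _ h => h.1.ne rfl⟩

/-- The vertex `gG(v)` of the Bass–Serre tree. -/
def coset (v : V) (g : 𝒢.completion) : Σ v, 𝒢.completion ⧸ (𝒢.toCompletion v).range :=
  ⟨v, QuotientGroup.mk g⟩

theorem coset_eq_iff {v : V} {g h : 𝒢.completion} :
    𝒢.coset v g = 𝒢.coset v h ↔ g⁻¹ * h ∈ (𝒢.toCompletion v).range := by
  simp [coset, QuotientGroup.eq]

theorem coset_mul (v : V) (g : 𝒢.completion) (k : 𝒢.vert v) :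
    𝒢.coset v (g * 𝒢.toCompletion v k) = 𝒢.coset v g := by
  rw [eq_comm, coset_eq_iff, inv_mul_cancel_left]
  exact ⟨k, rfl⟩

theorem exists_coset_eq (x : Σ v, 𝒢.completion ⧸ (𝒢.toCompletion v).range) :
    ∃ v g, x = 𝒢.coset v g := by
  obtain ⟨v, x⟩ := x
  obtain ⟨g, rfl⟩ := QuotientGroup.mk_surjective x
  exact ⟨v, g, rfl⟩

theorem bassSerre_adj_coset {v w : V} (h : T.Adj v w) (g : 𝒢.completion) :
    𝒢.bassSerre.Adj (𝒢.coset v g) (𝒢.coset w g) :=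
  ⟨h, g, rfl, rfl⟩

theorem exists_of_bassSerre_adj {x y : Σ v, 𝒢.completion ⧸ (𝒢.toCompletion v).range}
    (h : 𝒢.bassSerre.Adj x y) :
    ∃ v w g, T.Adj v w ∧ x = 𝒢.coset v g ∧ y = 𝒢.coset w g := by
  obtain ⟨v, x⟩ := x
  obtain ⟨w, y⟩ := y
  obtain ⟨h, g, hx, hy⟩ := h
  exact ⟨v, w, g, h, congrArg (Sigma.mk v) hx, congrArg (Sigma.mk w) hy⟩

theorem bassSerre_reachable_coset (v w : V) (g : 𝒢.completion) :
    𝒢.bassSerre.Reachable (𝒢.coset v g) (𝒢.coset w g) := by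
  obtain ⟨p⟩ := 𝒢.isTree.connected v w
  induction p with
  | nil => exact SimpleGraph.Reachable.refl _
  | cons h _ ih => exact (𝒢.bassSerre_adj_coset h g).reachable.trans ih

/-- The completion acts on the Bass–Serre tree by left multiplication. -/
instance : MulAction 𝒢.completion (Σ v, 𝒢.completion ⧸ (𝒢.toCompletion v).range) where
  smul g x := ⟨x.1, g • x.2⟩
  one_smul x := Sigma.ext rfl (heq_of_eq (one_smul _ x.2))
  mul_smul g h x := Sigma.ext rfl (heq_of_eq (mul_smul g h x.2))

theorem smul_coset (g : 𝒢.completion) (v : V) (h : 𝒢.completion) :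
    g • 𝒢.coset v h = 𝒢.coset v (g * h) := rfl

theorem smul_coset_eq_iff {g : 𝒢.completion} {v : V} {h : 𝒢.completion} :
    g • 𝒢.coset v h = 𝒢.coset v h ↔ h⁻¹ * g * h ∈ (𝒢.toCompletion v).range := by
  rw [smul_coset, eq_comm, coset_eq_iff, mul_assoc]

theorem bassSerre_adj_smul (g : 𝒢.completion)
    {x y : Σ v, 𝒢.completion ⧸ (𝒢.toCompletion v).range} (h : 𝒢.bassSerre.Adj x y) :
    𝒢.bassSerre.Adj (g • x) (g • y) := by
  obtain ⟨v, w, k, hvw, rfl, rfl⟩ := 𝒢.exists_of_bassSerre_adj h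
  exact 𝒢.bassSerre_adj_coset hvw (g * k)

theorem isTree_bassSerre : 𝒢.bassSerre.IsTree := by
  have hne : Nonempty V := 𝒢.isTree.connected.nonempty
  have hconn : ∀ (v : V) g, 𝒢.bassSerre.Reachable (𝒢.coset v g) (𝒢.coset v 1) := by
    intro v g
    let f : ∀ g : 𝒢.completion, 𝒢.bassSerre →g 𝒢.bassSerre :=
      fun g => ⟨fun x => g • x, fun h => 𝒢.bassSerre_adj_smul g h⟩
    induction g using 𝒢.completion_induction with
    | one => exact SimpleGraph.Reachable.refl _
    | mul w k x ih =>
      have h := (ih.trans (𝒢.bassSerre_reachable_coset v w 1)).map (f (𝒢.toCompletion w k))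
      have h1 : f (𝒢.toCompletion w k) (𝒢.coset w 1) = 𝒢.coset w 1 := by
        refine (𝒢.smul_coset _ _ _).trans ?_
        simpa using 𝒢.coset_mul w 1 k
      rw [h1] at h
      exact h.trans (𝒢.bassSerre_reachable_coset w v 1)
  have : Nonempty (Σ v, 𝒢.completion ⧸ (𝒢.toCompletion v).range) := ⟨𝒢.coset hne.some 1⟩
  refine ⟨⟨fun x y => ?_⟩, ?_⟩
  · obtain ⟨v, g, rfl⟩ := 𝒢.exists_coset_eq x
    obtain ⟨w, h, rfl⟩ := 𝒢.exists_coset_eq y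
    exact (hconn v g).trans ((𝒢.bassSerre_reachable_coset v w 1).trans (hconn w h).symm)
  · refine SimpleGraph.isAcyclic_iff_forall_adj_isBridge.2 fun x y hxy => ?_
    obtain ⟨v₀, w₀, g₀, h₀, rfl, rfl⟩ := 𝒢.exists_of_bassSerre_adj hxy
    rw [SimpleGraph.isBridge_iff]
    let e₀ : T.edgeSet := ⟨s(v₀, w₀), h₀⟩
    obtain ⟨f, hf, hf0, hf1, hf2⟩ := 𝒢.exists_separation e₀ (Sym2.mem_mk_left v₀ w₀)
      (Sym2.mem_mk_right v₀ w₀) h₀.ne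
    let Φ : (Σ v, 𝒢.completion ⧸ (𝒢.toCompletion v).range) → ZMod 2 := fun x =>
      Quotient.liftOn' x.2 (fun g => f x.1 (g₀⁻¹ * g)) (by
        intro g h hgh
        obtain ⟨k, hk⟩ := QuotientGroup.leftRel_apply.1 hgh
        have := hf x.1 k (g₀⁻¹ * g)
        rw [hk, mul_assoc, mul_inv_cancel_left] at this
        exact this.symm)
    have hΦ : ∀ v g, Φ (𝒢.coset v g) = f v (g₀⁻¹ * g) := fun _ _ => rfl
    -- across an edge of the Bass–Serre tree over `e₀`, other than the deleted one
    have key : ∀ g, s(𝒢.coset v₀ g, 𝒢.coset w₀ g) ≠ s(𝒢.coset v₀ g₀, 𝒢.coset w₀ g₀) →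
        Φ (𝒢.coset v₀ g) = Φ (𝒢.coset w₀ g) := by
      intro g hne
      rw [hΦ, hΦ]
      refine hf2 _ fun hmem => hne ?_
      have hmem' := hmem
      rw [𝒢.edgeImage_eq e₀ v₀ w₀ _ (Sym2.mem_mk_right v₀ w₀)] at hmem'
      rw [𝒢.coset_eq_iff.2 (𝒢.edgeImage_le _ _ _ hmem),
        𝒢.coset_eq_iff.2 (𝒢.edgeImage_le _ _ _ hmem')]
    have hstep : ∀ x y, (𝒢.bassSerre.deleteEdges
        {s(𝒢.coset v₀ g₀, 𝒢.coset w₀ g₀)}).Adj x y → Φ x = Φ y := by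
      intro x y h
      rw [SimpleGraph.deleteEdges_adj] at h
      obtain ⟨h, hxy⟩ := h
      obtain ⟨v, w, g, hvw, rfl, rfl⟩ := 𝒢.exists_of_bassSerre_adj h
      by_cases he : s(v, w) = e₀
      · rcases Sym2.eq_iff.1 he with ⟨rfl, rfl⟩ | ⟨rfl, rfl⟩
        · exact key g hxy
        · exact (key g fun h => hxy (Sym2.eq_swap.trans h)).symm
      · rw [hΦ, hΦ, hf0 v w hvw he]
    rintro ⟨p⟩
    have hconst : ∀ {x y} (p : (𝒢.bassSerre.deleteEdges
        {s(𝒢.coset v₀ g₀, 𝒢.coset w₀ g₀)}).Walk x y), Φ x = Φ y := by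
      intro x y p
      induction p with
      | nil => rfl
      | cons h _ ih => exact (hstep _ _ h).trans ih
    refine hf1 1 (one_mem _) ?_
    have := hconst p
    rwa [hΦ, hΦ, inv_mul_cancel] at this

/-- A finite subgroup of the completion is conjugate to a subgroup of a vertex group, as it fixes a
vertex of the Bass–Serre tree. -/
theorem exists_conj_le_range (P : Subgroup 𝒢.completion) [Finite P] :
    ∃ v, ∃ g : 𝒢.completion, ∀ x ∈ P, g⁻¹ * x * g ∈ (𝒢.toCompletion v).range := by
  obtain ⟨x, hx⟩ := 𝒢.isTree_bassSerre.exists_fixed_of_finite (K := P)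
    (fun k _ _ h => 𝒢.bassSerre_adj_smul k h) (fun k x h => h.1.ne rfl)
  obtain ⟨v, g, rfl⟩ := 𝒢.exists_coset_eq x
  exact ⟨v, g, fun x hxP => 𝒢.smul_coset_eq_iff.1 (hx ⟨x, hxP⟩)⟩

end TreeOfGroups

/-! ### Conjugacy of homomorphisms in a fusion system -/

/-- A homomorphism into the range of an injective homomorphism lifts. -/
theorem MonoidHom.exists_lift_of_injective {K H G : Type*} [Group K] [Group H] [Group G]
    {t : H →* G} (ht : Function.Injective t) (f : K →* G) (hf : ∀ x, f x ∈ t.range) :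
    ∃ a : K →* H, ∀ x, t (a x) = f x :=
  ⟨(MonoidHom.ofInjective ht).symm.toMonoidHom.comp (f.codRestrict t.range hf), fun x =>
    MonoidHom.apply_ofInjective_symm ht ⟨f x, hf x⟩⟩

namespace FusionSystem

variable {p : ℕ} {S : Type u₁} [Group S] {R : Type u₂} [Group R]

/-- Two homomorphisms `a`, `b` from a group to `S` are conjugate in a fusion system on `S` if some
morphism `β` of the fusion system satisfies `b = β ∘ a`. Source and target of `β` may be any
subgroups for which this makes sense. -/
def Related {K : Type*} [Group K] (F : FusionSystem p S) (a b : K →* S) : Prop :=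
  ∃ (A B : Subgroup S), ∃ β ∈ F.Hom A B, ∀ x, ∃ h : a x ∈ A, (β ⟨a x, h⟩ : S) = b x

/-- Restrictions of morphisms of a fusion system, in source and target, are morphisms. -/
theorem mem_hom_of_restrict (F : FusionSystem p S) {A B A₀ B₀ : Subgroup S} (hA : A₀ ≤ A)
    {β : A →* B} (hβ : β ∈ F.Hom A B) (β₀ : A₀ →* B₀)
    (h : ∀ x : A₀, (β₀ x : S) = β ⟨x, hA x.2⟩) : β₀ ∈ F.Hom A₀ B₀ := by
  have h1 : β.comp (Subgroup.inclusion hA) ∈ F.Hom A₀ B :=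
    F.comp_mem _ _ _ _ _ (F.conj_mem _ _ _ ⟨1, fun x => by simp⟩) hβ
  have hle : (B.subtype.comp (β.comp (Subgroup.inclusion hA))).range ≤ B₀ := by
    rintro _ ⟨x, rfl⟩
    exact (congrArg (· ∈ B₀) (h x)).mp (β₀ x).2
  have h2 := F.comp_mem _ _ _ _ (Subgroup.inclusion hle) (F.factor _ _ _ h1).1
    (F.conj_mem _ _ _ ⟨1, fun x => by simp⟩)
  convert h2 using 1
  ext x
  exact h x

theorem Related.exists_hom {K : Type*} [Group K] {F : FusionSystem p S} {a b : K →* S}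
    (h : F.Related a b) {A B : Subgroup S} (hA : A ≤ a.range) (hB : b.range ≤ B) :
    ∃ β ∈ F.Hom A B, ∀ x, ∀ hx : a x ∈ A, (β ⟨a x, hx⟩ : S) = b x := by
  obtain ⟨A', B', β, hβ, hab⟩ := h
  have hA' : A ≤ A' := by
    intro y hy
    obtain ⟨x, rfl⟩ := hA hy
    exact (hab x).1
  let β₀ : A →* B := (B'.subtype.comp (β.comp (Subgroup.inclusion hA'))).codRestrict B (by
    rintro ⟨y, hy⟩
    obtain ⟨x, rfl⟩ := hA hy
    obtain ⟨_, e⟩ := hab x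
    exact hB ⟨x, e.symm⟩)
  refine ⟨β₀, F.mem_hom_of_restrict hA' hβ β₀ fun _ => rfl, fun x hx => ?_⟩
  obtain ⟨_, e⟩ := hab x
  exact e

theorem Related.trans {K : Type*} [Group K] {F : FusionSystem p S} {a b c : K →* S}
    (h : F.Related a b) (h' : F.Related b c) : F.Related a c := by
  obtain ⟨β, hβ, e⟩ := h.exists_hom (le_refl a.range) (le_refl b.range)
  obtain ⟨γ, hγ, e'⟩ := h'.exists_hom (le_refl b.range) (le_refl c.range)
  refine ⟨_, _, _, F.comp_mem _ _ _ _ _ hβ hγ, fun x => ⟨⟨x, rfl⟩, ?_⟩⟩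
  have hx : β ⟨a x, ⟨x, rfl⟩⟩ = ⟨b x, ⟨x, rfl⟩⟩ := Subtype.ext (e x _)
  rw [MonoidHom.comp_apply, hx]
  exact e' x _

theorem Related.map {K : Type*} [Group K] {F : FusionSystem p S} {E : FusionSystem p R}
    {φ : S →* R} (hφ : F.IsMorphism E φ) {a b : K →* S} (h : F.Related a b) :
    E.Related (φ.comp a) (φ.comp b) := by
  obtain ⟨A, B, β, hβ, e⟩ := h
  obtain ⟨γ, hγ, hγβ⟩ := hφ A B β hβ
  refine ⟨_, _, γ, hγ, fun x => ?_⟩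
  obtain ⟨hx, e⟩ := e x
  refine ⟨⟨a x, hx, rfl⟩, ?_⟩
  have := congrArg Subtype.val (DFunLike.congr_fun hγβ ⟨a x, hx⟩)
  refine this.symm.trans ?_
  rw [MonoidHom.comp_apply, MonoidHom.comp_apply, ← e]
  rfl

/-- The morphisms of fusion systems are the homomorphisms which preserve conjugacy. -/
theorem isMorphism_iff {F : FusionSystem p S} {E : FusionSystem p R} {φ : S →* R} :
    F.IsMorphism E φ ↔ ∀ (P Q : Subgroup S), ∀ α ∈ F.Hom P Q,
      E.Related (φ.comp P.subtype) (φ.comp (Q.subtype.comp α)) := by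
  refine ⟨fun h P Q α hα => Related.map h ⟨P, Q, α, hα, fun x => ⟨x.2, rfl⟩⟩, ?_⟩
  intro h P Q α hα
  obtain ⟨β, hβ, e⟩ := (h P Q α hα).exists_hom (A := P.map φ) (B := Q.map φ)
    (by rintro _ ⟨x, hx, rfl⟩; exact ⟨⟨x, hx⟩, rfl⟩)
    (by rintro _ ⟨x, rfl⟩; exact ⟨α x, (α x).2, rfl⟩)
  refine ⟨β, hβ, ?_⟩
  ext x
  exact (e x ⟨x, x.2, rfl⟩).symm

theorem IsMorphism.comp {Q : Type u₃} [Group Q] {F : FusionSystem p S} {E : FusionSystem p R}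
    {D : FusionSystem p Q} {ψ : R →* Q} {φ : S →* R} (hψ : E.IsMorphism D ψ)
    (hφ : F.IsMorphism E φ) : F.IsMorphism D (ψ.comp φ) :=
  isMorphism_iff.2 fun P Q α hα => (isMorphism_iff.1 hφ P Q α hα).map hψ

theorem isMorphism_id (F : FusionSystem p S) : F.IsMorphism F (MonoidHom.id S) :=
  isMorphism_iff.2 fun P Q α hα => ⟨P, Q, α, hα, fun x => ⟨x.2, rfl⟩⟩

theorem IsIso.symm {F : FusionSystem p S} {E : FusionSystem p R} {θ : S ≃* R}
    (h : F.IsIso E θ) : E.IsIso F θ.symm :=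
  ⟨h.2, h.1⟩

theorem IsIso.trans {Q : Type u₃} [Group Q] {F : FusionSystem p S} {E : FusionSystem p R}
    {D : FusionSystem p Q} {θ : S ≃* R} {η : R ≃* Q} (h : F.IsIso E θ) (h' : E.IsIso D η) :
    F.IsIso D (θ.trans η) :=
  ⟨h'.1.comp h.1, h.2.comp h'.2⟩

/-- The fusion system on a finite `p`-group `S` whose morphisms are induced by conjugation in `G`,
with respect to an embedding `t` of `S` in `G`. -/
def ofHom {G : Type*} [Group G] (t : S →* G) (ht : Function.Injective t) (hfin : Finite S)
    (hp : IsPGroup p S) : FusionSystem p S where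
  Hom P Q := {φ | ∃ g : G, ∀ x : P, t (φ x) = g⁻¹ * t x * g}
  finite := hfin
  isPGroup := hp
  conj_mem := by
    rintro P Q φ ⟨s, hs⟩
    exact ⟨t s, fun x => by simp [hs x]⟩
  injective := by
    rintro P Q φ ⟨g, hg⟩ x y hxy
    have h := hg x
    rw [hxy, hg y] at h
    exact (Subtype.ext (ht (mul_left_cancel (mul_right_cancel h)))).symm
  comp_mem := by
    rintro P Q R φ ψ ⟨g, hg⟩ ⟨h, hh⟩
    exact ⟨g * h, fun x => by simp [hh, hg, mul_assoc]⟩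
  factor := by
    rintro P Q φ ⟨g, hg⟩
    have hinj : Function.Injective (Q.subtype.comp φ) := by
      intro x y hxy
      have h := hg x
      rw [show (φ x : S) = φ y from hxy, hg y] at h
      exact (Subtype.ext (ht (mul_left_cancel (mul_right_cancel h)))).symm
    refine ⟨⟨g, hg⟩, (MonoidHom.ofInjective hinj).symm.toMonoidHom, ⟨g⁻¹, fun y => ?_⟩, ?_, ?_⟩
    · obtain ⟨x, rfl⟩ := (MonoidHom.ofInjective hinj).surjective y
      have h : t ((MonoidHom.ofInjective hinj) x) = g⁻¹ * t x * g := hg x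
      simp [h, mul_assoc]
    · ext x
      exact congrArg Subtype.val ((MonoidHom.ofInjective hinj).symm_apply_apply x)
    · ext y
      exact congrArg Subtype.val ((MonoidHom.ofInjective hinj).apply_symm_apply y)

theorem related_ofHom {G : Type*} [Group G] {t : S →* G} {ht : Function.Injective t}
    {hfin : Finite S} {hp : IsPGroup p S} {K : Type*} [Group K] {a b : K →* S} (g : G)
    (h : ∀ x, t (b x) = g⁻¹ * t (a x) * g) : (ofHom t ht hfin hp).Related a b := by
  have hker : ∀ x, a x = 1 → b x = 1 := fun x hx => ht (by rw [h, hx]; simp)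
  let β : a.range →* b.range := (QuotientGroup.lift a.ker b.rangeRestrict
    (fun x hx => Subtype.ext (hker x hx))).comp
      (QuotientGroup.quotientKerEquivRange a).symm.toMonoidHom
  have hβ : ∀ x, β ⟨a x, ⟨x, rfl⟩⟩ = ⟨b x, ⟨x, rfl⟩⟩ := by
    intro x
    have : (QuotientGroup.quotientKerEquivRange a).symm ⟨a x, ⟨x, rfl⟩⟩ = QuotientGroup.mk x :=
      (MulEquiv.symm_apply_eq _).2 rfl
    simp only [β, MonoidHom.comp_apply, MulEquiv.coe_toMonoidHom, this]
    rfl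
  refine ⟨a.range, b.range, β, ⟨g, ?_⟩, fun x => ⟨⟨x, rfl⟩, congrArg Subtype.val (hβ x)⟩⟩
  rintro ⟨_, x, rfl⟩
  rw [hβ, h]

theorem related_ofGroup {G : Type*} [Group G] {S : Subgroup G} {hfin : Finite S}
    {hp : IsPGroup p S} {K : Type*} [Group K] {a b : K →* S} (g : G)
    (h : ∀ x, (b x : G) = g⁻¹ * a x * g) : (ofGroup S hfin hp).Related a b :=
  related_ofHom (ht := S.subtype_injective) (hfin := hfin) (hp := hp) g h

/-- Identification of a `p`-group with its image under an embedding `t` in `G`. -/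
theorem isIso_ofHom {G : Type*} [Group G] {t : S →* G} {ht : Function.Injective t}
    {hfin : Finite S} {hp : IsPGroup p S} {hfin' : Finite t.range} {hp' : IsPGroup p t.range} :
    (ofHom t ht hfin hp).IsIso (ofGroup t.range hfin' hp') (MonoidHom.ofInjective ht) := by
  constructor
  · refine isMorphism_iff.2 ?_
    rintro P Q α ⟨g, hg⟩
    exact related_ofGroup g hg
  · refine isMorphism_iff.2 ?_
    rintro P Q α ⟨g, hg⟩
    refine related_ofHom g fun x => ?_
    simpa using hg x

/-- Conjugation by `g`, as an isomorphism between the fusion systems of conjugate subgroups. -/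
theorem isIso_ofGroup_conj {G : Type*} [Group G] {S S' : Subgroup G} {hfin : Finite S}
    {hp : IsPGroup p S} {hfin' : Finite S'} {hp' : IsPGroup p S'} (g : G) (θ : S ≃* S')
    (hθ : ∀ x, (θ x : G) = g⁻¹ * x * g) :
    (ofGroup S hfin hp).IsIso (ofGroup S' hfin' hp') θ := by
  have hθ' : ∀ y, (θ.symm y : G) = g * y * g⁻¹ := by
    intro y
    obtain ⟨x, rfl⟩ := θ.surjective y
    simp [hθ, mul_assoc]
  constructor
  · refine isMorphism_iff.2 ?_
    rintro P Q α ⟨h, hh⟩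
    exact related_ofGroup (g⁻¹ * h * g) fun x => by simp [hθ, hh, mul_assoc]
  · refine isMorphism_iff.2 ?_
    rintro P Q α ⟨h, hh⟩
    exact related_ofGroup (g * h * g⁻¹) fun x => by simp [hθ', hh, mul_assoc]

end FusionSystem

/-- Sylow `p`-subgroups, in the sense of finite `p`-subgroups absorbing all others up to
conjugation, are conjugate: each of two of them is no larger than the other. -/
theorem IsSylowSubgroup.exists_mulEquiv {p : ℕ} {G : Type*} [Group G] {S S' : Subgroup G}
    (h : IsSylowSubgroup p S) (h' : IsSylowSubgroup p S') :
    ∃ (g : G) (θ : S ≃* S'), ∀ x, (θ x : G) = g⁻¹ * x * g := by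
  obtain ⟨g, hg⟩ := h'.2.2 S h.1 h.2.1
  obtain ⟨k, hk⟩ := h.2.2 S' h'.1 h'.2.1
  have := h.1
  have := h'.1
  have conj : ∀ {S S' : Subgroup G} (g : G), (∀ x ∈ S, g⁻¹ * x * g ∈ S') →
      ∃ φ : S →* S', Function.Injective φ ∧ ∀ x, (φ x : G) = g⁻¹ * x * g := by
    intro S S' g hg
    refine ⟨{ toFun := fun x => ⟨g⁻¹ * x * g, hg x x.2⟩
              map_one' := by ext; simp
              map_mul' := fun x y => by ext; simp [mul_assoc] }, fun x y e => ?_, fun x => rfl⟩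
    exact Subtype.ext (mul_left_cancel (mul_right_cancel (congrArg Subtype.val e)))
  obtain ⟨φ, hφ, hφg⟩ := conj g hg
  obtain ⟨ψ, hψ, -⟩ := conj k hk
  have hbij : Function.Bijective φ :=
    hφ.bijective_of_nat_card_le (Nat.card_le_card_of_injective ψ hψ)
  exact ⟨g, MulEquiv.ofBijective φ hbij, hφg⟩

/-- A homomorphism from a `p`-group to a finite group is conjugate to one into a given Sylow
`p`-subgroup. -/
theorem Sylow.exists_conj_mem {p : ℕ} [Fact p.Prime] {G : Type*} [Group G] [Finite G]
    (S : Sylow p G) {K : Type*} [Group K] (hK : IsPGroup p K) (f : K →* G) :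
    ∃ g, ∀ x, g⁻¹ * f x * g ∈ S := by
  obtain ⟨Q, hQ⟩ := (hK.of_surjective f.rangeRestrict f.rangeRestrict_surjective).exists_le_sylow
  obtain ⟨g, rfl⟩ := MulAction.exists_smul_eq G Q S
  refine ⟨g⁻¹, fun x => ?_⟩
  rw [inv_inv, ← MulAut.conj_apply]
  exact Subgroup.smul_mem_pointwise_smul _ _ _ (hQ ⟨x, rfl⟩)

namespace SylowChoice

open FusionSystem TreeOfFusionSystems

variable {V : Type w} {T : SimpleGraph V} {p : ℕ} {𝒢 : TreeOfGroups.{w, u} T} (c : SylowChoice p 𝒢)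

/-! ### Subgroups of the completion -/

theorem toCompletion_apply (v : V) (x : (c.sylV v : Subgroup (𝒢.vert v))) :
    c.toCompletion v x = 𝒢.toCompletion v x := rfl

theorem toCompletion_injective [𝒢.IsFinite] (v : V) : Function.Injective (c.toCompletion v) :=
  (𝒢.toCompletion_injective v).comp (Subgroup.subtype_injective _)

/-- In the completion, the embedding of `S(e)` in `S(v)` is conjugation by `g_{ev}`. -/
theorem toCompletion_map (e : T.edgeSet) (v : V) (hv : v ∈ (e : Sym2 V))
    (x : (c.sylE e : Subgroup (𝒢.edge e))) :
    c.toCompletion v (c.map e v hv x) = (𝒢.toCompletion v (c.g e v hv))⁻¹ *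
      𝒢.toCompletion v (𝒢.map e v hv x) * 𝒢.toCompletion v (c.g e v hv) := by
  simp [toCompletion_apply, map]

/-- Under hypothesis (H), the groups `S(v)` can be mapped to `S(v_*)` compatibly, by composing
the maps `S(v) ≅ S(e) → S(w)` along the path from `v` to `v_*`. In the completion these maps are
conjugations, and the legs of any cocone factor through them. -/
theorem exists_map_root [h𝒢 : 𝒢.IsFinite] {vstar : V} (hH : c.inducedTree.SatisfiesH vstar) :
    ∃ j : ∀ v, (c.sylV v : Subgroup (𝒢.vert v)) →* (c.sylV vstar : Subgroup (𝒢.vert vstar)),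
      j vstar = MonoidHom.id _ ∧
      (∀ v, ∃ γ : 𝒢.completion, ∀ x, c.toCompletion vstar (j v x) =
        γ⁻¹ * c.toCompletion v x * γ) ∧
      (∀ v (D : c.inducedTree.Cocone), (D.legV vstar).comp (j v) = D.legV v) ∧
      ∀ (e : T.edgeSet) v w (hv : v ∈ (e : Sym2 V)) (hw : w ∈ (e : Sym2 V)),
        (j v).comp (c.map e v hv) = (j w).comp (c.map e w hw) := by
  obtain ⟨j, hj, hje⟩ := 𝒢.isTree.exists_family vstar
    (A := fun v => {j : (c.sylV v : Subgroup (𝒢.vert v)) →*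
        (c.sylV vstar : Subgroup (𝒢.vert vstar)) //
      (∃ γ : 𝒢.completion, ∀ x, c.toCompletion vstar (j x) = γ⁻¹ * c.toCompletion v x * γ) ∧
      ∀ (D : c.inducedTree.Cocone), (D.legV vstar).comp j = D.legV v})
    (fun v w j j' => ∀ (e : T.edgeSet) (hv : v ∈ (e : Sym2 V)) (hw : w ∈ (e : Sym2 V)),
        j.1.comp (c.map e v hv) = j'.1.comp (c.map e w hw))
    (fun v w j j' h e hw hv => (h e hv hw).symm)
    ⟨MonoidHom.id _, ⟨1, fun x => by simp⟩, fun D => MonoidHom.comp_id _⟩ (by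
      rintro v w h q hq ⟨a, ⟨γ, hγ⟩, haD⟩
      let e : T.edgeSet := ⟨s(v, w), h⟩
      have hv : v ∈ (e : Sym2 V) := Sym2.mem_mk_left _ _
      have hw : w ∈ (e : Sym2 V) := Sym2.mem_mk_right _ _
      obtain ⟨ε⟩ := hH v ⟨_, hq⟩ e hv (by simp [e])
      have hfin : Finite (c.sylV v : Subgroup (𝒢.vert v)) :=
        have := h𝒢.vert v
        inferInstance
      have hbij : Function.Bijective (c.map e v hv) :=
        (c.map_injective e v hv).bijective_of_nat_card_le (Nat.card_congr ε.toEquiv).ge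
      let η := MulEquiv.ofBijective (c.map e v hv) hbij
      refine ⟨⟨a.comp ((c.map e w hw).comp η.symm.toMonoidHom),
        ⟨(𝒢.toCompletion v (c.g e v hv))⁻¹ * 𝒢.toCompletion w (c.g e w hw) * γ, fun x => ?_⟩,
        fun D => ?_⟩, fun e' hv' hw' => ?_⟩
      · obtain ⟨y, rfl⟩ := η.surjective x
        have h1 : c.toCompletion v (η y) = _ := c.toCompletion_map e v hv y
        rw [𝒢.toCompletion_map e v w hv hw] at h1
        have h2 := hγ (c.map e w hw y)
        rw [c.toCompletion_map] at h2
        rw [h1]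
        simp only [MonoidHom.comp_apply, MulEquiv.coe_toMonoidHom, MulEquiv.symm_apply_apply, h2]
        group
      · refine MonoidHom.ext fun x => ?_
        obtain ⟨y, rfl⟩ := η.surjective x
        have h1 : D.legV vstar (a (c.map e w hw y)) = D.legV w (c.map e w hw y) :=
          DFunLike.congr_fun (haD D) _
        have h2 : D.legV w (c.map e w hw y) = D.legV v (c.map e v hv y) :=
          DFunLike.congr_fun ((D.comm e w hw).trans (D.comm e v hv).symm) y
        exact (congrArg (fun y => D.legV vstar (a (c.map e w hw y)))
          (η.symm_apply_apply y)).trans (h1.trans h2)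
      · obtain rfl : e' = e := Subtype.ext ((Sym2.mem_and_mem_iff h.ne).1 ⟨hv', hw'⟩)
        ext1 x
        exact congrArg (fun y => a (c.map e w hw y)) (η.symm_apply_apply x))
  refine ⟨fun v => (j v).1, congrArg Subtype.val hj, fun v => (j v).2.1, fun v => (j v).2.2, ?_⟩
  intro e v w hv hw
  by_cases hvw : v = w
  · subst hvw; rfl
  · have he := (Sym2.mem_and_mem_iff hvw).1 ⟨hv, hw⟩
    exact hje v w (by rw [← SimpleGraph.mem_edgeSet, ← he]; exact e.2) e hv hw

/-- Every finite `p`-subgroup of the completion is conjugate to a subgroup of a vertex group, hence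
of some `S(v)`, and finally of `S(v_*)`. -/
theorem isSylowSubgroup_image [Fact p.Prime] [h𝒢 : 𝒢.IsFinite] {vstar : V}
    (hH : c.inducedTree.SatisfiesH vstar) : IsSylowSubgroup p (c.image vstar) := by
  have := h𝒢.vert
  refine ⟨Finite.of_surjective _ (c.toCompletion vstar).rangeRestrict_surjective,
    IsPGroup.of_surjective (c.sylV vstar).isPGroup' (c.toCompletion vstar).rangeRestrict
      (c.toCompletion vstar).rangeRestrict_surjective, fun P hfin hP => ?_⟩
  obtain ⟨v, g, hg⟩ := 𝒢.exists_conj_le_range P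
  obtain ⟨f, hf⟩ := MonoidHom.exists_lift_of_injective (𝒢.toCompletion_injective v)
    ((MulAut.conj g⁻¹).toMonoidHom.comp P.subtype) (fun x => by simpa using hg x x.2)
  obtain ⟨k, hk⟩ := (c.sylV v).exists_conj_mem hP f
  obtain ⟨j, -, hj, -⟩ := c.exists_map_root hH
  obtain ⟨γ, hγ⟩ := hj v
  refine ⟨g * 𝒢.toCompletion v k * γ, fun x hx => ⟨j v ⟨_, hk ⟨x, hx⟩⟩, ?_⟩⟩
  rw [hγ, toCompletion_apply]
  simp [hf, mul_assoc]

/-! ### The universal property of `F_{S(v_*)}(G_T)` -/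

/-- Homomorphisms into `S(v)` conjugate under elements of one coset of `G(v)` differ by a
morphism of `F(v)`. -/
theorem related_of_coset_eq [𝒢.IsFinite] (D : c.inducedTree.Cocone) {K : Type*} [Group K]
    (τ : K →* 𝒢.completion) {v w : V} {g h : 𝒢.completion} (hgh : 𝒢.coset v g = 𝒢.coset w h)
    (a : K →* (c.sylV v : Subgroup (𝒢.vert v))) (ha : ∀ k, c.toCompletion v (a k) = g⁻¹ * τ k * g)
    (b : K →* (c.sylV w : Subgroup (𝒢.vert w)))
    (hb : ∀ k, c.toCompletion w (b k) = h⁻¹ * τ k * h) :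
    D.sys.Related ((D.legV v).comp a) ((D.legV w).comp b) := by
  obtain rfl : v = w := congrArg Sigma.fst hgh
  obtain ⟨m, hm⟩ := 𝒢.coset_eq_iff.1 hgh
  refine Related.map (D.legV_isMorphism v) (related_ofGroup m fun k => ?_)
  apply 𝒢.toCompletion_injective v
  have h1 := hb k
  have h2 := ha k
  rw [toCompletion_apply] at h1 h2
  simp [h1, h2, hm, mul_assoc]

/-- Let `a`, `b` be homomorphisms from a `p`-group `K` to `S(v)` and `S(w)` which are conjugate in
the completion. Then they become conjugate in the fusion system of any cocone. Indeed `K` acts on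
the Bass–Serre tree, and it fixes the vertices of a path. Along an edge of this path over an edge
`e` of the tree of groups, the homomorphism passes from one vertex group to another by way of
`S(e)`; at a vertex of the path over `v`, it changes by a morphism of `F(v)`. -/
theorem related_of_walk [Fact p.Prime] [h𝒢 : 𝒢.IsFinite] (D : c.inducedTree.Cocone) {K : Type*}
    [Group K] (hK : IsPGroup p K) (τ : K →* 𝒢.completion)
    {x y : Σ v, 𝒢.completion ⧸ (𝒢.toCompletion v).range} (q : 𝒢.bassSerre.Walk x y)
    (hfix : ∀ z ∈ q.support, ∀ k, τ k • z = z) :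
    ∀ {v w : V} {g h : 𝒢.completion}, x = 𝒢.coset v g → y = 𝒢.coset w h →
    ∀ (a : K →* (c.sylV v : Subgroup (𝒢.vert v))),
      (∀ k, c.toCompletion v (a k) = g⁻¹ * τ k * g) →
    ∀ (b : K →* (c.sylV w : Subgroup (𝒢.vert w))),
      (∀ k, c.toCompletion w (b k) = h⁻¹ * τ k * h) →
    D.sys.Related ((D.legV v).comp a) ((D.legV w).comp b) := by
  induction q with
  | nil =>
    intro v w g h hg hh a ha b hb
    exact c.related_of_coset_eq D τ (hg.symm.trans hh) a ha b hb
  | @cons x z y hxz q ih =>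
    intro v w g h hg hh a ha b hb
    obtain ⟨v₀, w₀, g₀, h₀, rfl, rfl⟩ := 𝒢.exists_of_bassSerre_adj hxz
    let e : T.edgeSet := ⟨s(v₀, w₀), h₀⟩
    have hv : v₀ ∈ (e : Sym2 V) := Sym2.mem_mk_left _ _
    have hw : w₀ ∈ (e : Sym2 V) := Sym2.mem_mk_right _ _
    have := h𝒢.edge e
    obtain ⟨f, hf⟩ := MonoidHom.exists_lift_of_injective
      (t := (𝒢.toCompletion v₀).comp (𝒢.map e v₀ hv))
      ((𝒢.toCompletion_injective v₀).comp (𝒢.map_injective e v₀ hv))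
      ((MulAut.conj g₀⁻¹).toMonoidHom.comp τ) (fun k => by
        refine 𝒢.inf_range_le_edgeImage e hv hw h₀.ne ⟨?_, ?_⟩
        · simpa using 𝒢.smul_coset_eq_iff.1 (hfix _ (by simp) k)
        · simpa using 𝒢.smul_coset_eq_iff.1 (hfix (𝒢.coset w₀ g₀) (by simp) k))
    have hfv : ∀ k, 𝒢.toCompletion v₀ (𝒢.map e v₀ hv (f k)) = g₀⁻¹ * τ k * g₀ := fun k => by
      simpa using hf k
    have hfw : ∀ k, 𝒢.toCompletion w₀ (𝒢.map e w₀ hw (f k)) = g₀⁻¹ * τ k * g₀ := fun k => by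
      rw [← hfv, 𝒢.toCompletion_map e w₀ v₀ hw hv]
    obtain ⟨m, hm⟩ := (c.sylE e).exists_conj_mem hK f
    let f' : K →* (c.sylE e : Subgroup (𝒢.edge e)) :=
      ((MulAut.conj m⁻¹).toMonoidHom.comp f).codRestrict _
        (fun k => by
          change _ ∈ c.sylE e
          simpa using hm k)
    have hf' : ∀ k, (f' k : 𝒢.edge e) = m⁻¹ * f k * m := fun k => by simp [f']
    have hleg : (D.legV v₀).comp ((c.map e v₀ hv).comp f') =
        (D.legV w₀).comp ((c.map e w₀ hw).comp f') :=
      MonoidHom.ext fun k =>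
        DFunLike.congr_fun ((D.comm e v₀ hv).trans (D.comm e w₀ hw).symm) (f' k)
    refine Related.trans (b := (D.legV v₀).comp ((c.map e v₀ hv).comp f')) ?_ ?_
    · refine c.related_of_coset_eq D τ (h := g₀ * 𝒢.toCompletion v₀ (𝒢.map e v₀ hv m) *
        𝒢.toCompletion v₀ (c.g e v₀ hv)) ?_ a ha _ (fun k => ?_)
      · rw [𝒢.coset_mul, 𝒢.coset_mul, hg]
      · rw [MonoidHom.comp_apply, c.toCompletion_map, hf']
        simp [hfv, mul_assoc]
    · rw [hleg]
      refine ih (fun z hz => hfix z (by simp [hz])) (g := g₀ * 𝒢.toCompletion w₀ (𝒢.map e w₀ hw m) *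
        𝒢.toCompletion w₀ (c.g e w₀ hw)) ?_ hh _ (fun k => ?_) b hb
      · rw [𝒢.coset_mul, 𝒢.coset_mul]
      · rw [MonoidHom.comp_apply, c.toCompletion_map, hf']
        simp [hfw, mul_assoc]

/-- Every cocone respects conjugation in the completion. -/
theorem related_of_conj [Fact p.Prime] [h𝒢 : 𝒢.IsFinite] (D : c.inducedTree.Cocone) {K : Type*}
    [Group K] (hK : IsPGroup p K) {v w : V} (a : K →* (c.sylV v : Subgroup (𝒢.vert v)))
    (b : K →* (c.sylV w : Subgroup (𝒢.vert w))) (g : 𝒢.completion)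
    (hab : ∀ k, c.toCompletion w (b k) = g⁻¹ * c.toCompletion v (a k) * g) :
    D.sys.Related ((D.legV v).comp a) ((D.legV w).comp b) := by
  obtain ⟨q, hq, -⟩ := 𝒢.isTree_bassSerre.existsUnique_path (𝒢.coset v 1) (𝒢.coset w g)
  refine c.related_of_walk D hK ((c.toCompletion v).comp a) q (fun z hz k => ?_) rfl rfl a
    (fun k => by simp) b hab
  let f : 𝒢.bassSerre →g 𝒢.bassSerre :=
    ⟨fun x => c.toCompletion v (a k) • x, fun h => 𝒢.bassSerre_adj_smul _ h⟩
  refine 𝒢.isTree_bassSerre.fixed_of_mem_support f (MulAction.injective _) ?_ ?_ hq z hz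
  · exact 𝒢.smul_coset_eq_iff.2 ⟨a k, by simp [toCompletion_apply]⟩
  · exact 𝒢.smul_coset_eq_iff.2 ⟨b k, hab k⟩

/-- The fusion system `F_{S(v_*)}(G_T)`, carried by the group `S(v_*)` itself, underlies a
completion whose leg at `v_*` is the identity. -/
theorem exists_isCompletion [Fact p.Prime] [h𝒢 : 𝒢.IsFinite] {vstar : V}
    (hH : c.inducedTree.SatisfiesH vstar) :
    ∃ C : c.inducedTree.Cocone, C.IsCompletion ∧
      ∃ θ : c.image vstar ≃* C.carrier,
        (∀ s : (c.sylV vstar : Subgroup (𝒢.vert vstar)),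
          θ ((c.toCompletion vstar).rangeRestrict s) = C.legV vstar s) ∧
        (c.completionFusion vstar).IsIso C.sys θ := by
  have := h𝒢.vert
  obtain ⟨j, hj, hγ, hD, hcomm⟩ := c.exists_map_root hH
  have hinj := c.toCompletion_injective vstar
  let sys : FusionSystem p (c.sylV vstar : Subgroup (𝒢.vert vstar)) :=
    FusionSystem.ofHom (c.toCompletion vstar) hinj inferInstance (c.sylV vstar).isPGroup'
  have hlegV : ∀ v (hfin : Finite (c.sylV v : Subgroup (𝒢.vert v)))
      (hp : IsPGroup p (c.sylV v : Subgroup (𝒢.vert v))),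
      (ofGroup (c.sylV v : Subgroup (𝒢.vert v)) hfin hp).IsMorphism sys (j v) := by
    intro v hfin hp
    obtain ⟨γ, hγ⟩ := hγ v
    refine FusionSystem.isMorphism_iff.2 ?_
    rintro P Q α ⟨h, hα⟩
    refine related_ofHom (γ⁻¹ * 𝒢.toCompletion v h * γ) fun x => ?_
    simp [hγ, toCompletion_apply, hα, mul_assoc]
  -- the choice of the end of `e` does not matter, by `hcomm`
  let legE : ∀ e : T.edgeSet, (c.sylE e : Subgroup (𝒢.edge e)) →*
      (c.sylV vstar : Subgroup (𝒢.vert vstar)) := fun e =>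
    (j (e : Sym2 V).out.1).comp (c.map e _ (Sym2.out_fst_mem _))
  let C : c.inducedTree.Cocone :=
    { carrier := (c.sylV vstar : Subgroup (𝒢.vert vstar))
      sys := sys
      legV := j
      legE := legE
      legV_isMorphism := fun v => hlegV v _ _
      legE_isMorphism := fun e => (hlegV _ _ _).comp
        (c.inducedTree.map_isInjectiveMorphism e _ (Sym2.out_fst_mem _)).1
      comm := fun e v hv => hcomm e v _ hv _ }
  refine ⟨C, fun D => ⟨D.legV vstar, ⟨?_, fun v => hD v D, fun e => ?_⟩, ?_⟩,
    (MonoidHom.ofInjective hinj).symm, fun s => ?_, ?_⟩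
  · refine FusionSystem.isMorphism_iff.2 ?_
    rintro P Q α ⟨g, hg⟩
    exact c.related_of_conj D ((c.sylV vstar).isPGroup'.to_subgroup P) P.subtype
      (Q.subtype.comp α) g hg
  · refine Eq.trans ?_ (D.comm e _ (Sym2.out_fst_mem _))
    exact congrArg (fun l => MonoidHom.comp l (c.inducedTree.S.map e _ (Sym2.out_fst_mem _)))
      (hD (e : Sym2 V).out.1 D)
  · rintro ψ ⟨-, hψ, -⟩
    rw [← hψ vstar]
    change ψ = ψ.comp (j vstar)
    rw [hj]
    rfl
  · change _ = j vstar s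
    rw [hj]
    exact (MonoidHom.ofInjective hinj).symm_apply_apply s
  · exact (isIso_ofHom (ht := hinj)).symm

end SylowChoice

namespace TreeOfFusionSystems

open FusionSystem

/-- Completions of a tree of fusion systems are unique up to isomorphism. -/
theorem Cocone.IsCompletion.exists_isIso {V : Type w} {T : SimpleGraph V} {p : ℕ}
    {𝓕 : TreeOfFusionSystems.{w, u} p T} {C C' : 𝓕.Cocone} (h : C.IsCompletion)
    (h' : C'.IsCompletion) : ∃ θ : C.carrier ≃* C'.carrier,
      C.sys.IsIso C'.sys θ ∧ ∀ v, θ.toMonoidHom.comp (C.legV v) = C'.legV v := by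
  obtain ⟨φ, ⟨hφ, hφV, hφE⟩, -⟩ := h C'
  obtain ⟨ψ, ⟨hψ, hψV, hψE⟩, -⟩ := h' C
  have h1 : ψ.comp φ = MonoidHom.id _ := (h C).unique
    ⟨hψ.comp hφ, fun v => by rw [MonoidHom.comp_assoc, hφV, hψV],
      fun e => by rw [MonoidHom.comp_assoc, hφE, hψE]⟩
    ⟨isMorphism_id _, fun v => MonoidHom.id_comp _, fun e => MonoidHom.id_comp _⟩
  have h2 : φ.comp ψ = MonoidHom.id _ := (h' C').unique
    ⟨hφ.comp hψ, fun v => by rw [MonoidHom.comp_assoc, hψV, hφV],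
      fun e => by rw [MonoidHom.comp_assoc, hψE, hφE]⟩
    ⟨isMorphism_id _, fun v => MonoidHom.id_comp _, fun e => MonoidHom.id_comp _⟩
  exact ⟨MonoidHom.toMulEquiv φ ψ h1 h2, ⟨hφ, hψ⟩, hφV⟩

end TreeOfFusionSystems

/-- Every completion is identified with the fusion system of `G_T` on `S(v_*)`. -/
theorem SylowChoice.exists_isIso_of_isCompletion {V : Type w} {T : SimpleGraph V} {p : ℕ}
    [Fact p.Prime] {𝒢 : TreeOfGroups.{w, u} T} [𝒢.IsFinite] (c : SylowChoice p 𝒢) {vstar : V}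
    (hH : c.inducedTree.SatisfiesH vstar) {C : c.inducedTree.Cocone} (hC : C.IsCompletion) :
    ∃ θ : c.image vstar ≃* C.carrier,
      (∀ s : (c.sylV vstar : Subgroup (𝒢.vert vstar)),
        θ ((c.toCompletion vstar).rangeRestrict s) = C.legV vstar s) ∧
      (c.completionFusion vstar).IsIso C.sys θ := by
  obtain ⟨C₀, hC₀, θ₀, hθ₀, hiso₀⟩ := c.exists_isCompletion hH
  obtain ⟨θ, hiso, hθ⟩ := hC₀.exists_isIso hC
  refine ⟨θ₀.trans θ, fun s => ?_, hiso₀.trans hiso⟩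
  exact (congrArg θ (hθ₀ s)).trans (DFunLike.congr_fun (hθ vstar) s)

theorem theoremA {V : Type w} {T : SimpleGraph V} (p : ℕ) [Fact p.Prime]
    (𝒢 : TreeOfGroups.{w, u} T) [𝒢.IsFinite] (c : SylowChoice p 𝒢) (vstar : V)
    (hH : c.inducedTree.SatisfiesH vstar) :
    -- `S(v_*)` embeds in the completion `G_T` and is a Sylow `p`-subgroup of it
    (Function.Injective (c.toCompletion vstar) ∧ IsSylowSubgroup p (c.image vstar)) ∧
    -- a completion `F_T` exists
    (∃ C : c.inducedTree.Cocone, C.IsCompletion) ∧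
    -- `F_T` is `F_{S(v_*)}(G_T)`, with `S(v_*)` identified with its images in `F_T` and in `G_T`
    (∀ C : c.inducedTree.Cocone, C.IsCompletion →
      ∃ θ : c.image vstar ≃* C.carrier,
        (∀ s : (c.sylV vstar : Subgroup (𝒢.vert vstar)),
          θ ((c.toCompletion vstar).rangeRestrict s) = C.legV vstar s) ∧
        (c.completionFusion vstar).IsIso C.sys θ) ∧
    -- `F_T` does not depend on the choice of the induced tree of fusion systems
    (∀ (c' : SylowChoice p 𝒢) (vstar' : V), c'.inducedTree.SatisfiesH vstar' →
      ∀ (C : c.inducedTree.Cocone) (C' : c'.inducedTree.Cocone),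
        C.IsCompletion → C'.IsCompletion →
          ∃ φ : C.carrier ≃* C'.carrier, C.sys.IsIso C'.sys φ) := by

  refine ⟨⟨c.toCompletion_injective vstar, c.isSylowSubgroup_image hH⟩,
    (c.exists_isCompletion hH).imp fun _ h => h.1,
    fun C hC => c.exists_isIso_of_isCompletion hH hC, ?_⟩
  intro c' vstar' hH' C C' hC hC'
  obtain ⟨θ, -, hθ⟩ := c.exists_isIso_of_isCompletion hH hC
  obtain ⟨θ', -, hθ'⟩ := c'.exists_isIso_of_isCompletion hH' hC'
  obtain ⟨g, η, hη⟩ :=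
    (c.isSylowSubgroup_image hH).exists_mulEquiv (c'.isSylowSubgroup_image hH')
  exact ⟨_, (hθ.symm.trans (FusionSystem.isIso_ofGroup_conj g η hη)).trans hθ'⟩
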